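/- For $n\ge 1$ let $K_n=(V_n,E_n)$ be the complete graph on $n$ nodes. For edge weights $X=(X_e)_{e\in E_n}$ and a configuration $\gamma\in\{\pm1\}^{V_n}$ let $\mathrm{obj}_X(\gamma)=\sum_{\{u,v\}\in E_n:\ \gamma(u)\ne\gamma(v)}X_{\{u,v\}}$ be the weight of the cut given by $\gamma$. The 2-FLIP algorithm for local Max-Cut starts from an arbitrary configuration and, as long as the weight of the cut can be strictly increased by flipping the signs of one or two nodes, makes such a move, chosen by an arbitrary pivoting rule; the only restriction on the rule is that it never flips two nodes when flipping just one of these two would give a cut of strictly larger weight than flipping both. Pure 2-FLIP is the variant in which every move flips exactly two nodes (and strictly increases the weight of the cut), with no restriction on the pivoting rule. **Theorem.** There are an absolute constant $C$ and a sequence $\delta_n\to0$ such that the following holds for all $n$ and all $\phi>0$. Let $(\mathcal X_e)_{e\in E_n}$ be probability distributions, each supported on $[-1,1]$ and with a density bounded from above by $\phi$, and let the weights $X_e\sim\mathcal X_e$ be drawn independently. Then, with probability at least $1-\delta_n$ over the draw of $X$, for every initial configuration and every pivoting rule as above, 2-FLIP on $K_n$ with weights $X$ terminates after at most $\phi\,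 n^{C(\log n)^{10}}$ steps. The same bound holds, with probability at least $1-\delta_n$, for every execution of Pure 2-FLIP. -/

import Mathlib

open MeasureTheory Filter Topology

/-- The edges of the complete graph `K_n` on the vertex set `Fin n`, as unordered pairs. -/
abbrev EdgeK (n : ℕ) : Type := (⊤ : SimpleGraph (Fin n)).edgeSet

/-- A configuration in `{±1}^n`: it encodes the partition into the nodes of sign `-1` and the
nodes of sign `1`. -/
abbrev Configuration (n : ℕ) : Type := Fin n → ℤˣ

/-- The weight of the cut given by the configuration `γ`: the sum of the weights of the edges
`{u, v}` with `γ u ≠ γ v`. -/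
noncomputable def cutWeight {n : ℕ} (X : EdgeK n → ℝ) (γ : Configuration n) : ℝ :=
  open Classical in ∑ e : EdgeK n, if (Sym2.map γ e.1).IsDiag then 0 else X e

/-- One step of 2-FLIP from `γ` to `γ'` with edge weights `X`: at most two nodes are flipped, the
cut strictly improves, and flipping only one of the flipped nodes does not give a cut that is
strictly better than that of `γ'`. (For a single flip the last condition is trivial.) -/
def TwoFlipStep {n : ℕ} (X : EdgeK n → ℝ) (γ γ' : Configuration n) : Prop :=
  hammingDist γ γ' ≤ 2 ∧ cutWeight X γ < cutWeight X γ' ∧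
    ∀ u : Fin n, γ u ≠ γ' u → cutWeight X (Function.update γ u (γ' u)) ≤ cutWeight X γ'

/-- One step of Pure 2-FLIP: exactly two nodes are flipped and the cut strictly improves. -/
def PureTwoFlipStep {n : ℕ} (X : EdgeK n → ℝ) (γ γ' : Configuration n) : Prop :=
  hammingDist γ γ' = 2 ∧ cutWeight X γ < cutWeight X γ'

/-- A local search whose admissible steps are given by `step`, and which stops only when no
admissible step exists, takes at most `B` steps, whatever the initial configuration and whatever
the pivoting rule (which may use the weights, the history and randomness): every run
`γ 0, γ 1, …, γ N` of consecutive admissible steps has `N ≤ B`. -/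
def TerminatesWithin {α : Type*} (step : α → α → Prop) (B : ℝ) : Prop :=
  ∀ (N : ℕ) (γ : ℕ → α), (∀ i < N, step (γ i) (γ (i + 1))) → (N : ℝ) ≤ B

/-- `μ` is a probability distribution on `ℝ` that is supported on `[-1, 1]` and has a density
(with respect to Lebesgue measure) that is bounded from above by `φ`. -/
structure IsSmoothedWeightLaw (φ : ℝ) (μ : Measure ℝ) : Prop where
  isProbabilityMeasure : IsProbabilityMeasure μ
  supported : μ (Set.Icc (-1) 1)ᶜ = 0
  density : ∃ f : ℝ → ENNReal, Measurable f ∧ (∀ x, f x ≤ ENNReal.ofReal φ) ∧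
    μ = volume.withDensity f

/-!
Why local search takes quasipolynomially many steps. A block of `2 ^ κ` consecutive improving
moves, with `2 ^ κ` about `n ^ 3`, improves the cut by more than some `ε = n ^ (-polylog n) / φ`,
with high probability for all blocks at once. As the cut value stays in an interval of length
`n ^ 2`, this bounds the number of blocks. If a block gains at most `ε`, then so does each of its
moves, and the point is to find many linearly independent combinations of these gains, since each
gain is a linear form in the weights. A union bound over all runs is out of reach, because the
form depends on the signs of all `n` nodes; it has to be taken over the *records* of the moves of
a window only, which list the nodes that move and their signs. So the combinations must cancel the
nodes that do not move in the window.

*Runs.* The pivoting rule of 2-FLIP, or for Pure 2-FLIP the parity of the number of flips, makes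
each run reduced (`IsReducedRun`): it does not come back to a configuration that arises by a part
of an earlier move. Hence the configurations at two moves of a node `u` from the same sign differ
at a node that takes part in neither move (`IsReducedRun.exists_witness`).

*Windows.* By a count over all dyadic scales, some dyadic window has a fraction `1 / (2 κ)` of moves
in which each node that moves is active in at least `d` moves of the window, and some node, the
mover, in fewer than `D` moves (`exists_good_window`), where `d` and `D` are polynomials in `κ`.

*Colours.* Colour the nodes at random: two test colours, one colour for movers and one for their
partners. Among `m` moves of the same mover with pairwise witnesses, the expected number of
different configurations of the test nodes, counted over moves with a correctly coloured partner,
is at least of order `√m` (`sqrt_rowWeight_le_sum_traceCount`, by induction over the nodes). As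
`m < D` this costs only a factor polynomial in `κ`, so that some colouring retains many moves
(`exists_colouring`).

*Cycles.* View each retained move as an edge between its mover and its partner. This multigraph has
many more edges than vertices, since its vertices are active nodes. Breadth-first search in a
subgraph of minimal degree at least three finds a cycle, or two cycles and a path, of length
`O(κ)`, which carries an integer combination of moves with zero boundary and at most three moves
at each vertex; deleting its movers, which have few moves, and repeating gives many of them with
disjoint sets of movers (`exists_short_cycles`). Zero boundary means that the nodes that do not
move cancel out. Any three different sign vectors are affinely independent
(`exists_coordinate_sum_ne_zero`), so that the combination contains the weight of some edge from
one of its movers to a test node, and this edge occurs in no other of the combinations. Hence a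
window of length `ℓ` yields `r ≥ ℓ / polylog n` such combinations (`exists_isCertificate`).

*Probability.* Given the other weights, the private edges of the combinations are independent with
bounded densities, so that all `r` combinations are small with probability at most `q ^ r`
(`measure_forms_le`). For `q = (4 n ^ 3) ^ (-polylog n)` this beats the number `(4 n ^ 2) ^ ℓ` of
records (`measure_exists_hasSlowWindow_le`).
-/

/-! ### Short cycles in multigraphs -/

section ShortCycles

variable {ι ν : Type*}

lemma sum_abs_add_le (T : Finset ι) (b c : ι → ℤ) :
    ∑ t ∈ T, |(b + c) t| ≤ ∑ t ∈ T, |b t| + ∑ t ∈ T, |c t| := by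
  rw [← Finset.sum_add_distrib]
  exact Finset.sum_le_sum fun t _ => abs_add_le _ _

variable [DecidableEq ν]

/-- The value at the vertex `z` of the boundary of the integer 1-chain `b` in the multigraph with
edge set `T`, where the edge `t` runs from `snd t` to `fst t`. -/
def edgeBoundary (T : Finset ι) (fst snd : ι → ν) (b : ι → ℤ) (z : ν) : ℤ :=
  ∑ t ∈ T, b t * ((if fst t = z then 1 else 0) - (if snd t = z then 1 else 0))

lemma edgeBoundary_add (T : Finset ι) (fst snd : ι → ν) (b c : ι → ℤ) (z : ν) :
    edgeBoundary T fst snd (b + c) z = edgeBoundary T fst snd b z + edgeBoundary T fst snd c z := by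
  simp [edgeBoundary, add_mul, Finset.sum_add_distrib]

lemma edgeBoundary_neg (T : Finset ι) (fst snd : ι → ν) (b : ι → ℤ) (z : ν) :
    edgeBoundary T fst snd (-b) z = - edgeBoundary T fst snd b z := by
  simp [edgeBoundary]

variable [DecidableEq ι]

lemma edgeBoundary_single {T : Finset ι} (fst snd : ι → ν) {t : ι} (ht : t ∈ T) (a : ℤ) (z : ν) :
    edgeBoundary T fst snd (Pi.single t a) z =
      a * ((if fst t = z then 1 else 0) - (if snd t = z then 1 else 0)) := by
  unfold edgeBoundary
  rw [Finset.sum_eq_single_of_mem t ht]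
  · simp
  · intro s _ hs
    simp [Pi.single_eq_of_ne hs]

lemma sum_abs_single_le (T : Finset ι) (t : ι) (a : ℤ) :
    ∑ s ∈ T, |(Pi.single t a : ι → ℤ) s| ≤ |a| := by
  have h : ∀ s, |(Pi.single t a : ι → ℤ) s| = if s = t then |a| else 0 := by
    intro s
    by_cases h : s = t
    · subst h; simp
    · simp [h]
  simp only [h, Finset.sum_ite_eq']
  split_ifs <;> simp

/-- In a rooted forest given by parent edges `par`, the path from the root to a vertex `v` of depth
`k` is a chain of length `k` with boundary `v - root`. At each vertex it has at most one edge
other than the parent edge, and none at `v`. -/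
lemma exists_path_chain (T : Finset ι) (fst snd : ι → ν) (depth : ν → ℕ) (par : ν → ι) (root : ν)
    (R : ℕ) (h0 : ∀ v, depth v = 0 → v = root)
    (hpar : ∀ v k, depth v = k + 1 → k + 1 ≤ R → par v ∈ T ∧
      ((fst (par v) = v ∧ depth (snd (par v)) = k) ∨
        (snd (par v) = v ∧ depth (fst (par v)) = k))) :
    ∀ k ≤ R, ∀ v, depth v = k → ∃ p : ι → ℤ,
      (∀ t, p t ≠ 0 → t ∈ T ∧ depth (fst t) ≤ k ∧ depth (snd t) ≤ k ∧
        ∃ w, t = par w ∧ depth w ≠ 0 ∧ depth w ≤ k) ∧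
      ∑ t ∈ T, |p t| ≤ k ∧
      (∀ z, edgeBoundary T fst snd p z = (if v = z then 1 else 0) - (if root = z then 1 else 0)) ∧
      (∀ z, ∀ t t', p t ≠ 0 → p t' ≠ 0 → t ≠ par z → t' ≠ par z → (fst t = z ∨ snd t = z) →
        (fst t' = z ∨ snd t' = z) → t = t') ∧
      (∀ t, p t ≠ 0 → (fst t = v ∨ snd t = v) → t = par v) := by
  intro k
  induction k with
  | zero =>
    intro _ v hv
    obtain rfl := h0 v hv
    refine ⟨0, by simp, by simp, by simp [edgeBoundary], by simp, by simp⟩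
  | succ k ih =>
    intro hk v hv
    obtain ⟨hT, hends⟩ := hpar v k hv hk
    obtain ⟨v', a, hv', hends', ha, hbd⟩ : ∃ (v' : ν) (a : ℤ), depth v' = k ∧
        ((fst (par v) = v ∧ snd (par v) = v') ∨ (snd (par v) = v ∧ fst (par v) = v')) ∧
        (|a| = 1) ∧
        ∀ z, a * ((if fst (par v) = z then 1 else 0) - (if snd (par v) = z then 1 else 0)) =
          (if v = z then 1 else 0) - (if v' = z then 1 else 0) := by
      rcases hends with ⟨h1, h2⟩ | ⟨h1, h2⟩
      · exact ⟨snd (par v), 1, h2, Or.inl ⟨h1, rfl⟩, by simp, by intro z; simp [h1]⟩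
      · exact ⟨fst (par v), -1, h2, Or.inr ⟨h1, rfl⟩, by simp, by intro z; simp [h1]⟩
    obtain ⟨p, p1, p2, p3, p4, p5⟩ := ih (by omega) v' hv'
    have hsupp : ∀ t, (p + Pi.single (par v) a : ι → ℤ) t ≠ 0 → p t ≠ 0 ∨ t = par v := by
      intro t ht
      by_contra! h
      exact ht (by simp [h.1, h.2])
    have hnotv : ∀ t, p t ≠ 0 → ¬ (fst t = v ∨ snd t = v) := by
      intro t ht h
      obtain ⟨_, h1, h2, _⟩ := p1 t ht
      rcases h with h | h <;> have := congrArg depth h <;> omega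
    refine ⟨p + Pi.single (par v) a, ?_, ?_, ?_, ?_, ?_⟩
    · intro t ht
      rcases hsupp t ht with h | rfl
      · obtain ⟨h1, h2, h3, w, h4, h5, h6⟩ := p1 t h
        exact ⟨h1, by omega, by omega, w, h4, h5, by omega⟩
      · refine ⟨hT, ?_, ?_, v, rfl, by omega, by omega⟩ <;>
          rcases hends' with ⟨h1, h2⟩ | ⟨h1, h2⟩ <;> simp [h1, h2, hv, hv']
    · have h1 := sum_abs_add_le T p (Pi.single (par v) a)
      have h2 := sum_abs_single_le T (par v) a
      push_cast
      omega
    · intro z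
      rw [edgeBoundary_add, p3, edgeBoundary_single fst snd hT, hbd]
      ring
    · intro z t t' ht ht' hz hz' he he'
      have key : ∀ s, p s ≠ 0 → s ≠ par z → (fst s = z ∨ snd s = z) →
          par v ≠ par z → (fst (par v) = z ∨ snd (par v) = z) → False := by
        intro s hs hsz hse hvz hve
        have hzv : z = v' := by
          rcases hends' with ⟨h1, h2⟩ | ⟨h1, h2⟩ <;> rw [h1, h2] at hve <;>
            rcases hve with h | h
          · exact absurd (by rw [h]) hvz
          · exact h.symm
          · exact h.symm
          · exact absurd (by rw [h]) hvz
        subst hzv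
        exact hsz (p5 s hs hse)
      rcases hsupp t ht with h | rfl <;> rcases hsupp t' ht' with h' | rfl
      · exact p4 z t t' h h' hz hz' he he'
      · exact (key t h hz he hz' he').elim
      · exact (key t' h' hz' he' hz he).elim
      · rfl
    · intro t ht he
      rcases hsupp t ht with h | h
      · exact (hnotv t h he).elim
      · exact h

/-- Closing up two paths from the root by an edge `f` outside the forest gives a short cycle, and
this cycle has at most three edges at every vertex. -/
lemma exists_cycle_of_nontree_edge (T : Finset ι) (fst snd : ι → ν) (depth : ν → ℕ)
    (par : ν → ι) (root : ν)
    (R : ℕ) (h0 : ∀ v, depth v = 0 → v = root)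
    (hpar : ∀ v k, depth v = k + 1 → k + 1 ≤ R → par v ∈ T ∧
      ((fst (par v) = v ∧ depth (snd (par v)) = k) ∨
        (snd (par v) = v ∧ depth (fst (par v)) = k)))
    (f : ι) (hf : f ∈ T) (hf1 : depth (fst f) ≤ R) (hf2 : depth (snd f) ≤ R)
    (hfp : ∀ w, depth w ≠ 0 → depth w ≤ R → f ≠ par w) :
    ∃ b : ι → ℤ, (∀ t, b t ≠ 0 → t ∈ T) ∧ (∃ t, b t ≠ 0) ∧ ∑ t ∈ T, |b t| ≤ 2 * R + 1 ∧
      (∀ z, edgeBoundary T fst snd b z = 0) ∧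
      ∀ z, (T.filter fun t => b t ≠ 0 ∧ (fst t = z ∨ snd t = z)).card ≤ 3 := by
  obtain ⟨p, p1, p2, p3, p4, p5⟩ := exists_path_chain T fst snd depth par root R h0 hpar
    (depth (fst f)) hf1 (fst f) rfl
  obtain ⟨q, q1, q2, q3, q4, q5⟩ := exists_path_chain T fst snd depth par root R h0 hpar
    (depth (snd f)) hf2 (snd f) rfl
  have hpf : p f = 0 := by
    by_contra h
    obtain ⟨_, _, _, w, h1, h2, h3⟩ := p1 f h
    exact hfp w h2 (by omega) h1
  have hqf : q f = 0 := by
    by_contra h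
    obtain ⟨_, _, _, w, h1, h2, h3⟩ := q1 f h
    exact hfp w h2 (by omega) h1
  have hsupp : ∀ t, (Pi.single f 1 + (-p + q) : ι → ℤ) t ≠ 0 → t = f ∨ p t ≠ 0 ∨ q t ≠ 0 := by
    intro t ht
    by_contra! h
    exact ht (by simp [h.1, h.2.1, h.2.2])
  refine ⟨Pi.single f 1 + (-p + q), ?_, ⟨f, ?_⟩, ?_, ?_, ?_⟩
  · intro t ht
    rcases hsupp t ht with rfl | h | h
    · exact hf
    · exact (p1 t h).1
    · exact (q1 t h).1
  · simp [hpf, hqf]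
  · have h1 := sum_abs_add_le T (Pi.single f 1) (-p + q)
    have h2 := sum_abs_single_le T f 1
    have h3 := sum_abs_add_le T (-p) q
    have h4 : ∑ t ∈ T, |(-p) t| = ∑ t ∈ T, |p t| := by simp
    have h5 : |(1 : ℤ)| = 1 := rfl
    have : (depth (fst f) : ℤ) ≤ R := by exact_mod_cast hf1
    have : (depth (snd f) : ℤ) ≤ R := by exact_mod_cast hf2
    omega
  · intro z
    rw [edgeBoundary_add, edgeBoundary_add, edgeBoundary_neg, p3, q3,
      edgeBoundary_single fst snd hf]
    ring
  · intro z
    have hone : ∀ r : ι → ℤ, (∀ t t', r t ≠ 0 → r t' ≠ 0 → t ≠ par z → t' ≠ par z →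
        (fst t = z ∨ snd t = z) → (fst t' = z ∨ snd t' = z) → t = t') →
        (T.filter fun t => r t ≠ 0 ∧ t ≠ par z ∧ (fst t = z ∨ snd t = z)).card ≤ 1 := by
      intro r hr
      refine Finset.card_le_one.2 fun t ht t' ht' => ?_
      simp only [Finset.mem_filter] at ht ht'
      exact hr t t' ht.2.1 ht'.2.1 ht.2.2.1 ht'.2.2.1 ht.2.2.2 ht'.2.2.2
    set A := T.filter fun t => p t ≠ 0 ∧ t ≠ par z ∧ (fst t = z ∨ snd t = z) with hA
    set B := T.filter fun t => q t ≠ 0 ∧ t ≠ par z ∧ (fst t = z ∨ snd t = z) with hB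
    set F := T.filter fun t => t = f ∧ (fst t = z ∨ snd t = z) with hF
    have hA1 : A.card ≤ 1 := hone p (p4 z)
    have hB1 : B.card ≤ 1 := hone q (q4 z)
    have hF1 : F.card ≤ 1 := Finset.card_le_one.2 fun t ht t' ht' => by
      simp only [hF, Finset.mem_filter] at ht ht'
      rw [ht.2.1, ht'.2.1]
    have hsub : (T.filter fun t => (Pi.single f 1 + (-p + q) : ι → ℤ) t ≠ 0 ∧
        (fst t = z ∨ snd t = z)) ⊆ {par z} ∪ (F ∪ (A ∪ B)) := by
      intro t ht
      simp only [Finset.mem_filter] at ht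
      obtain ⟨h1, h2, h3⟩ := ht
      by_cases hz : t = par z
      · simp [hz]
      · rcases hsupp t h2 with h | h | h <;>
          simp [hA, hB, hF, h1, h, hz, h3]
        subst h
        simp [h1, h3]
    -- An end `z` of `f` carries no other edge of its own path.
    have hsum : F.card + (A.card + B.card) ≤ 2 := by
      by_cases hz : fst f = z ∨ snd f = z
      · rcases hz with hz | hz
        · have : A = ∅ := by
            refine Finset.filter_eq_empty_iff.2 fun t _ h => ?_
            subst hz
            exact h.2.1 (p5 t h.1 h.2.2)
          rw [this, Finset.card_empty]; omega
        · have : B = ∅ := by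
            refine Finset.filter_eq_empty_iff.2 fun t _ h => ?_
            subst hz
            exact h.2.1 (q5 t h.1 h.2.2)
          rw [this, Finset.card_empty]; omega
      · have : F = ∅ := by
          refine Finset.filter_eq_empty_iff.2 fun t _ h => ?_
          rw [h.1] at h
          exact hz h.2
        rw [this, Finset.card_empty]; omega
    have h1 := Finset.card_le_card hsub
    have h2 := Finset.card_union_le {par z} (F ∪ (A ∪ B))
    have h3 := Finset.card_union_le F (A ∪ B)
    have h4 := Finset.card_union_le A B
    rw [Finset.card_singleton] at h2
    omega

end ShortCycles

/-! ### Packing short cycles -/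

section ShortCycleExistence

variable {ι ν : Type*} [DecidableEq ν]

lemma sum_card_fiber_le (I : Finset ι) (B : Finset ν) (f : ι → ν) :
    ∑ z ∈ B, (I.filter fun t => f t = z).card ≤ I.card := by
  have h := Finset.card_eq_sum_card_fiberwise (s := I.filter fun t => f t ∈ B) (t := B) (f := f)
    (fun t ht => (Finset.mem_filter.1 (Finset.mem_coe.1 ht)).2)
  refine le_trans (le_of_eq ?_) (Finset.card_filter_le I fun t => f t ∈ B)
  rw [h]
  refine Finset.sum_congr rfl fun z hz => ?_
  congr 1
  ext t
  simp only [Finset.mem_filter]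
  constructor
  · rintro ⟨h1, rfl⟩
    exact ⟨⟨h1, hz⟩, rfl⟩
  · rintro ⟨⟨h1, _⟩, h2⟩
    exact ⟨h1, h2⟩

/-- The ball of radius `k` around `root` in the multigraph with edge set `T`. -/
def edgeBall (T : Finset ι) (fst snd : ι → ν) (root : ν) : ℕ → Finset ν
  | 0 => {root}
  | k + 1 => edgeBall T fst snd root k ∪
      ((T.filter fun t => snd t ∈ edgeBall T fst snd root k).image fst ∪
        (T.filter fun t => fst t ∈ edgeBall T fst snd root k).image snd)

lemma edgeBall_mono (T : Finset ι) (fst snd : ι → ν) (root : ν) :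
    Monotone (edgeBall T fst snd root) :=
  monotone_nat_of_le_succ fun _ => Finset.subset_union_left

lemma fst_mem_edgeBall {T : Finset ι} {fst snd : ι → ν} {root : ν} {k : ℕ} {t : ι} (ht : t ∈ T)
    (h : snd t ∈ edgeBall T fst snd root k) : fst t ∈ edgeBall T fst snd root (k + 1) := by
  simp only [edgeBall, Finset.mem_union, Finset.mem_image, Finset.mem_filter]
  exact Or.inr (Or.inl ⟨t, ⟨ht, h⟩, rfl⟩)

lemma snd_mem_edgeBall {T : Finset ι} {fst snd : ι → ν} {root : ν} {k : ℕ} {t : ι} (ht : t ∈ T)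
    (h : fst t ∈ edgeBall T fst snd root k) : snd t ∈ edgeBall T fst snd root (k + 1) := by
  simp only [edgeBall, Finset.mem_union, Finset.mem_image, Finset.mem_filter]
  exact Or.inr (Or.inr ⟨t, ⟨ht, h⟩, rfl⟩)

lemma edgeBall_subset {T : Finset ι} {fst snd : ι → ν} {root : ν} {S : Finset ν}
    (hS : ∀ t ∈ T, fst t ∈ S ∧ snd t ∈ S) (hroot : root ∈ S) (k : ℕ) :
    edgeBall T fst snd root k ⊆ S := by
  induction k with
  | zero => simpa [edgeBall] using hroot
  | succ k ih =>
    intro v hv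
    simp only [edgeBall, Finset.mem_union, Finset.mem_image, Finset.mem_filter] at hv
    rcases hv with hv | ⟨t, ⟨ht, _⟩, rfl⟩ | ⟨t, ⟨ht, _⟩, rfl⟩
    · exact ih hv
    · exact (hS t ht).1
    · exact (hS t ht).2

variable [DecidableEq ι]

/-- A multigraph with at most `s` vertices and minimal degree at least `3` has a cycle of length at
most `2 R + 1` as soon as `(3 / 2) ^ R > s`: while the balls around a vertex span trees, they
grow by a factor `3 / 2`. -/
lemma exists_short_cycle_of_degree (T : Finset ι) (fst snd : ι → ν)
    (S : Finset ν) (hS : ∀ t ∈ T, fst t ∈ S ∧ snd t ∈ S) (hSne : S.Nonempty)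
    (hdeg : ∀ z ∈ S, 3 ≤ (T.filter fun t => fst t = z ∨ snd t = z).card)
    (R : ℕ) (hR : S.card * 2 ^ R < 3 ^ R) :
    ∃ b : ι → ℤ, (∀ t, b t ≠ 0 → t ∈ T) ∧ (∃ t, b t ≠ 0) ∧ ∑ t ∈ T, |b t| ≤ 2 * R + 1 ∧
      (∀ z, edgeBoundary T fst snd b z = 0) ∧
      ∀ z, (T.filter fun t => b t ≠ 0 ∧ (fst t = z ∨ snd t = z)).card ≤ 3 := by
  obtain ⟨root, hroot⟩ := hSne
  obtain ⟨t₀, -⟩ : (T.filter fun t => fst t = root ∨ snd t = root).Nonempty :=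
    Finset.card_pos.1 (by have := hdeg root hroot; omega)
  set ball := edgeBall T fst snd root with hball
  have hex : ∀ v, ∃ k, v ∈ ball k ∨ R + 1 ≤ k := fun v => ⟨R + 1, Or.inr le_rfl⟩
  set depth : ν → ℕ := fun v => Nat.find (hex v) with hdepth
  have hle : ∀ v k, k ≤ R → (depth v ≤ k ↔ v ∈ ball k) := by
    intro v k hk
    constructor
    · intro h
      rcases Nat.find_spec (hex v) with h1 | h1
      · exact edgeBall_mono T fst snd root h h1
      · exact absurd (h1.trans h) (by omega)
    · exact fun h => Nat.find_le (Or.inl h)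
  have h0 : ∀ v, depth v = 0 → v = root := by
    intro v hv
    have := (hle v 0 (Nat.zero_le _)).1 hv.le
    simpa [hball, edgeBall] using this
  have hpar : ∀ v, ∃ t, ∀ k, depth v = k + 1 → k + 1 ≤ R → t ∈ T ∧
      ((fst t = v ∧ depth (snd t) = k) ∨ (snd t = v ∧ depth (fst t) = k)) := by
    intro v
    by_cases hv : depth v ≠ 0 ∧ depth v ≤ R
    · obtain ⟨k, hk⟩ := Nat.exists_eq_succ_of_ne_zero hv.1
      have h1 : v ∈ ball (k + 1) := (hle v _ (by omega)).1 (by omega)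
      have h2 : v ∉ ball k := fun h => by have := (hle v k (by omega)).2 h; omega
      simp only [hball, edgeBall, Finset.mem_union, Finset.mem_image, Finset.mem_filter] at h1
      rcases h1 with h1 | ⟨t, ⟨ht, h1⟩, rfl⟩ | ⟨t, ⟨ht, h1⟩, rfl⟩
      · exact absurd h1 h2
      · have h3 := (hle _ k (by omega)).2 h1
        refine ⟨t, fun k' hk' _ => ⟨ht, Or.inl ⟨rfl, ?_⟩⟩⟩
        by_contra h4
        have h5 := (hle _ (depth (snd t)) (by omega)).1 le_rfl
        have h6 := (hle _ (depth (snd t) + 1) (by omega)).2 (fst_mem_edgeBall ht h5)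
        omega
      · have h3 := (hle _ k (by omega)).2 h1
        refine ⟨t, fun k' hk' _ => ⟨ht, Or.inr ⟨rfl, ?_⟩⟩⟩
        by_contra h4
        have h5 := (hle _ (depth (fst t)) (by omega)).1 le_rfl
        have h6 := (hle _ (depth (fst t) + 1) (by omega)).2 (snd_mem_edgeBall ht h5)
        omega
    · exact ⟨t₀, fun k hk hk' => absurd ⟨by omega, by omega⟩ hv⟩
  choose par hpar using hpar
  by_cases hf : ∃ f ∈ T, depth (fst f) ≤ R ∧ depth (snd f) ≤ R ∧
      ∀ w, depth w ≠ 0 → depth w ≤ R → f ≠ par w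
  · obtain ⟨f, hfT, hf1, hf2, hfp⟩ := hf
    exact exists_cycle_of_nontree_edge T fst snd depth par root R h0 (fun v k => hpar v k)
      f hfT hf1 hf2 hfp
  · exfalso
    push Not at hf
    have hdroot : depth root = 0 := by
      have := (hle root 0 (Nat.zero_le _)).2 (by simp [hball, edgeBall])
      omega
    have grow : ∀ k, k + 1 ≤ R → 3 * (ball k).card ≤ 2 * (ball (k + 1)).card := by
      intro k hk
      set I := T.filter fun t => fst t ∈ ball k ∨ snd t ∈ ball k with hI
      have h1 : ∑ z ∈ ball k, (T.filter fun t => fst t = z ∨ snd t = z).card ≤ 2 * I.card := by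
        have : ∀ z ∈ ball k, (T.filter fun t => fst t = z ∨ snd t = z).card ≤
            (I.filter fun t => fst t = z).card + (I.filter fun t => snd t = z).card := by
          intro z hz
          refine le_trans (Finset.card_le_card ?_) (Finset.card_union_le _ _)
          intro t ht
          simp only [Finset.mem_filter, Finset.mem_union, hI] at ht ⊢
          rcases ht with ⟨h, rfl | rfl⟩ <;> simp [h, hz]
        refine (Finset.sum_le_sum this).trans ?_
        rw [Finset.sum_add_distrib]
        have h2 := sum_card_fiber_le I (ball k) fst
        have h3 := sum_card_fiber_le I (ball k) snd
        omega
      have h2 : 3 * (ball k).card ≤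
          ∑ z ∈ ball k, (T.filter fun t => fst t = z ∨ snd t = z).card := by
        rw [mul_comm, ← smul_eq_mul]
        exact Finset.card_nsmul_le_sum _ _ _ fun z hz =>
          hdeg z (edgeBall_subset hS hroot k hz)
      have h3 : I.card ≤ (ball (k + 1)).card := by
        refine le_trans (Finset.card_le_card ?_) (Finset.card_image_le (f := par))
        intro t ht
        simp only [hI, Finset.mem_filter] at ht
        have hb : fst t ∈ ball (k + 1) ∧ snd t ∈ ball (k + 1) := by
          rcases ht with ⟨hT, h | h⟩
          · exact ⟨edgeBall_mono T fst snd root (Nat.le_succ k) h, snd_mem_edgeBall hT h⟩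
          · exact ⟨fst_mem_edgeBall hT h, edgeBall_mono T fst snd root (Nat.le_succ k) h⟩
        have hd1 := (hle (fst t) (k + 1) hk).2 hb.1
        have hd2 := (hle (snd t) (k + 1) hk).2 hb.2
        obtain ⟨w, hw0, hwR, rfl⟩ := hf t ht.1 (by omega) (by omega)
        obtain ⟨j, hj⟩ := Nat.exists_eq_succ_of_ne_zero hw0
        refine Finset.mem_image.2 ⟨w, ?_, rfl⟩
        obtain ⟨_, ⟨h, _⟩ | ⟨h, _⟩⟩ := hpar w j hj (by omega)
        · rw [← h]; exact hb.1
        · rw [← h]; exact hb.2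
      omega
    have hpow : ∀ k ≤ R, 3 ^ k ≤ (ball k).card * 2 ^ k := by
      intro k
      induction k with
      | zero => intro _; simp [hball, edgeBall]
      | succ k ih =>
        intro hk
        have h1 := ih (by omega)
        have h2 := grow k hk
        calc 3 ^ (k + 1) = 3 * 3 ^ k := by ring
          _ ≤ 3 * ((ball k).card * 2 ^ k) := by gcongr
          _ = (3 * (ball k).card) * 2 ^ k := by ring
          _ ≤ (2 * (ball (k + 1)).card) * 2 ^ k := by gcongr
          _ = (ball (k + 1)).card * 2 ^ (k + 1) := by ring
    have h1 := hpow R le_rfl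
    have h2 := Finset.card_le_card (edgeBall_subset hS hroot R)
    have h3 : (ball R).card * 2 ^ R ≤ S.card * 2 ^ R := by gcongr
    omega

lemma exists_short_cycle (T : Finset ι) (fst snd : ι → ν) (hne : ∀ t ∈ T, fst t ≠ snd t)
    (S : Finset ν) (hS : ∀ t ∈ T, fst t ∈ S ∧ snd t ∈ S) (hSne : S.Nonempty)
    (hcard : 2 * S.card ≤ T.card) (R : ℕ) (hR : S.card * 2 ^ R < 3 ^ R) :
    ∃ b : ι → ℤ, (∀ t, b t ≠ 0 → t ∈ T) ∧ (∃ t, b t ≠ 0) ∧ ∑ t ∈ T, |b t| ≤ 2 * R + 1 ∧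
      (∀ z, edgeBoundary T fst snd b z = 0) ∧
      ∀ z, (T.filter fun t => b t ≠ 0 ∧ (fst t = z ∨ snd t = z)).card ≤ 3 := by
  -- A minimal vertex set spanning twice as many edges as vertices has minimal degree at least 3.
  set E : Finset ν → Finset ι := fun S' => T.filter fun t => fst t ∈ S' ∧ snd t ∈ S' with hE
  set F := S.powerset.filter fun S' => S'.Nonempty ∧ 2 * S'.card ≤ (E S').card with hF
  have hFne : F.Nonempty := by
    refine ⟨S, ?_⟩
    simp only [hF, Finset.mem_filter, Finset.mem_powerset]
    refine ⟨Finset.Subset.refl _, hSne, ?_⟩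
    simpa only [hE, Finset.filter_true_of_mem hS] using hcard
  obtain ⟨S₀, hS₀, hmin⟩ := Finset.exists_min_image F Finset.card hFne
  simp only [hF, Finset.mem_filter, Finset.mem_powerset] at hS₀ hmin
  obtain ⟨hS₀S, hS₀ne, hS₀card⟩ := hS₀
  have hsubT : E S₀ ⊆ T := Finset.filter_subset _ _
  have hdeg : ∀ z ∈ S₀, 3 ≤ ((E S₀).filter fun t => fst t = z ∨ snd t = z).card := by
    intro z hz
    have hsplit : (E S₀).card ≤ (E (S₀.erase z)).card +
        ((E S₀).filter fun t => fst t = z ∨ snd t = z).card := by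
      refine le_trans (Finset.card_le_card ?_) (Finset.card_union_le _ _)
      intro t ht
      simp only [hE, Finset.mem_filter, Finset.mem_union, Finset.mem_erase] at ht ⊢
      tauto
    have hce := Finset.card_erase_of_mem hz
    have hpos : 0 < S₀.card := Finset.card_pos.2 hS₀ne
    by_contra hlt
    rcases (S₀.erase z).eq_empty_or_nonempty with h | h
    · have hc : (E (S₀.erase z)).card = 0 := by simp [hE, h]
      have h1 : S₀ = {z} := by
        refine Finset.eq_singleton_iff_unique_mem.2 ⟨hz, fun y hy => ?_⟩
        by_contra hyz
        exact Finset.notMem_empty y (h ▸ Finset.mem_erase.2 ⟨hyz, hy⟩)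
      have h2 : E S₀ = ∅ := by
        refine Finset.filter_eq_empty_iff.2 fun t ht hh => ?_
        rw [h1, Finset.mem_singleton, Finset.mem_singleton] at hh
        exact hne t ht (hh.1.trans hh.2.symm)
      rw [h2, Finset.card_empty] at hS₀card
      omega
    · have := hmin (S₀.erase z) ⟨(Finset.erase_subset _ _).trans hS₀S, h, by omega⟩
      omega
  have hR₀ : S₀.card * 2 ^ R < 3 ^ R :=
    lt_of_le_of_lt (Nat.mul_le_mul_right _ (Finset.card_le_card hS₀S)) hR
  obtain ⟨b, b1, b2, b3, b4, b5⟩ := exists_short_cycle_of_degree (E S₀) fst snd S₀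
    (fun t ht => (Finset.mem_filter.1 ht).2) hS₀ne hdeg R hR₀
  have hz : ∀ t ∈ T, t ∉ E S₀ → b t = 0 := fun t _ ht => by
    by_contra h
    exact ht (b1 t h)
  refine ⟨b, fun t ht => hsubT (b1 t ht), b2, ?_, ?_, ?_⟩
  · rwa [← Finset.sum_subset hsubT fun t ht ht' => by simp [hz t ht ht']]
  · intro z
    rw [← b4 z]
    exact (Finset.sum_subset hsubT fun t ht ht' => by simp [hz t ht ht']).symm
  · intro z
    refine le_trans (Finset.card_le_card ?_) (b5 z)
    intro t ht
    simp only [Finset.mem_filter] at ht ⊢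
    exact ⟨b1 t ht.2.1, ht.2⟩

/-- A multigraph whose number of edges is large compared with the number of its vertices has many
short cycles that do not share any vertex of the form `fst t`. -/
lemma exists_short_cycles (fst snd : ι → ν) (S : Finset ν) (hSne : S.Nonempty) (R Δ : ℕ)
    (hR : S.card * 2 ^ R < 3 ^ R) (r : ℕ) :
    ∀ T : Finset ι, (∀ t ∈ T, fst t ≠ snd t) → (∀ t ∈ T, fst t ∈ S ∧ snd t ∈ S) →
      (∀ z, (T.filter fun t => fst t = z).card ≤ Δ) →
      (r - 1) * ((2 * R + 1) * Δ) + 2 * S.card ≤ T.card →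
    ∃ b : Fin r → ι → ℤ, (∀ i t, b i t ≠ 0 → t ∈ T) ∧ (∀ i, ∃ t, b i t ≠ 0) ∧
      (∀ i, ∑ t ∈ T, |b i t| ≤ 2 * R + 1) ∧
      (∀ i z, edgeBoundary T fst snd (b i) z = 0) ∧
      (∀ i z, (T.filter fun t => b i t ≠ 0 ∧ (fst t = z ∨ snd t = z)).card ≤ 3) ∧
      ∀ i j t t', i ≠ j → b i t ≠ 0 → b j t' ≠ 0 → fst t ≠ fst t' := by
  induction r with
  | zero =>
    intro T _ _ _ _
    exact ⟨Fin.elim0, fun i => i.elim0, fun i => i.elim0, fun i => i.elim0, fun i => i.elim0,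
      fun i => i.elim0, fun i => i.elim0⟩
  | succ r ih =>
    intro T hne hS hΔ hcard
    obtain ⟨b, b1, b2, b3, b4, b5⟩ := exists_short_cycle T fst snd hne S hS hSne (by omega) R hR
    -- Delete the edges at the vertices `fst t` of the cycle: at most `(2 * R + 1) * Δ` edges.
    set P : Finset ν := (T.filter fun t => b t ≠ 0).image fst with hP
    set T' := T.filter fun t => fst t ∉ P with hT'
    have hPcard : P.card ≤ 2 * R + 1 := by
      refine Finset.card_image_le.trans ?_
      have h1 : ((T.filter fun t => b t ≠ 0).card : ℤ) ≤ ∑ t ∈ T, |b t| := by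
        rw [Finset.card_filter]
        push_cast
        refine Finset.sum_le_sum fun t _ => ?_
        split_ifs with h
        · exact Int.one_le_abs h
        · exact abs_nonneg _
      exact_mod_cast h1.trans b3
    have hT'card : T.card ≤ T'.card + (2 * R + 1) * Δ := by
      have h1 := Finset.card_filter_add_card_filter_not (s := T) (fun t => fst t ∈ P)
      have h2 : (T.filter fun t => fst t ∈ P).card ≤ P.card * Δ := by
        rw [Finset.card_eq_sum_card_fiberwise (s := T.filter fun t => fst t ∈ P) (f := fst) (t := P)
          (fun t ht => (Finset.mem_filter.1 (Finset.mem_coe.1 ht)).2), ← smul_eq_mul]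
        refine Finset.sum_le_card_nsmul _ _ _ fun z _ => ?_
        refine le_trans (Finset.card_le_card ?_) (hΔ z)
        exact Finset.filter_subset_filter _ (Finset.filter_subset _ _)
      have h3 : P.card * Δ ≤ (2 * R + 1) * Δ := Nat.mul_le_mul_right _ hPcard
      simp only [hT']
      omega
    rcases Nat.eq_zero_or_pos r with rfl | hr
    · refine ⟨fun _ => b, fun _ => b1, fun _ => b2, fun _ => b3, fun _ => b4, fun _ => b5, ?_⟩
      intro i j _ _ hij
      exact absurd (Fin.ext (by omega)) hij
    have hsub : T' ⊆ T := Finset.filter_subset _ _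
    obtain ⟨c, c1, c2, c3, c4, c5, c6⟩ := ih T' (fun t ht => hne t (hsub ht))
      (fun t ht => hS t (hsub ht))
      (fun z => (Finset.card_le_card (Finset.filter_subset_filter _ hsub)).trans (hΔ z)) (by
        obtain ⟨q, rfl⟩ : ∃ q, r = q + 1 := ⟨r - 1, by omega⟩
        simp only [Nat.add_sub_cancel] at hcard ⊢
        rw [Nat.add_mul, one_mul] at hcard
        omega)
    have hz : ∀ i, ∀ t ∈ T, t ∉ T' → c i t = 0 := fun i t _ ht => by
      by_contra h
      exact ht (c1 i t h)
    have hdisj : ∀ i t t', b t ≠ 0 → c i t' ≠ 0 → fst t ≠ fst t' := by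
      intro i t t' ht ht' h
      refine (Finset.mem_filter.1 (c1 i t' ht')).2 (h ▸ ?_)
      exact Finset.mem_image_of_mem _ (Finset.mem_filter.2 ⟨b1 t ht, ht⟩)
    refine ⟨Fin.cons b c, ?_, ?_, ?_, ?_, ?_, ?_⟩
    · intro i
      refine Fin.cases b1 (fun i => ?_) i
      exact fun t ht => hsub (c1 i t ht)
    · intro i
      refine Fin.cases b2 (fun i => ?_) i
      exact c2 i
    · intro i
      refine Fin.cases b3 (fun i => ?_) i
      rw [Fin.cons_succ, ← Finset.sum_subset hsub fun t ht ht' => by simp [hz i t ht ht']]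
      exact c3 i
    · intro i
      refine Fin.cases b4 (fun i => ?_) i
      intro z
      rw [Fin.cons_succ, ← c4 i z]
      exact (Finset.sum_subset hsub fun t ht ht' => by simp [hz i t ht ht']).symm
    · intro i
      refine Fin.cases b5 (fun i => ?_) i
      intro z
      refine le_trans (Finset.card_le_card ?_) (c5 i z)
      intro t ht
      simp only [Finset.mem_filter, Fin.cons_succ] at ht ⊢
      exact ⟨c1 i t ht.2.1, ht.2⟩
    · intro i j t t'
      refine Fin.cases ?_ (fun i => ?_) i <;> refine Fin.cases ?_ (fun j => ?_) j
      · exact fun h => absurd rfl h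
      · exact fun _ h h' => hdisj j t t' h h'
      · exact fun _ h h' => (hdisj i t' t h' h).symm
      · exact fun hij h h' => c6 i j t t' (fun e => hij (by rw [e])) h h'

end ShortCycleExistence

/-- Any three distinct sign vectors are affinely independent: a nontrivial combination with
coefficient sum zero of at most three distinct sign vectors is nonzero. -/
lemma exists_coordinate_sum_ne_zero {ι κ : Type*} (F : Finset ι) (b : ι → ℤ) (y : ι → κ → ℤˣ)
    (hb : ∀ t ∈ F, b t ≠ 0) (hF : F.Nonempty) (hF3 : F.card ≤ 3) (hsum : ∑ t ∈ F, b t = 0)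
    (hy : ∀ s ∈ F, ∀ t ∈ F, s ≠ t → ∃ w, y s w ≠ y t w) :
    ∃ s ∈ F, ∃ t ∈ F, ∃ w, y s w ≠ y t w ∧ ∑ t ∈ F, b t * (y t w : ℤ) ≠ 0 := by
  obtain ⟨s, hs⟩ := hF
  obtain ⟨t, ht, hst⟩ : ∃ t ∈ F, s ≠ t := by
    by_contra! h
    have : F = {s} := Finset.eq_singleton_iff_unique_mem.2 ⟨hs, fun x hx => (h x hx).symm⟩
    rw [this, Finset.sum_singleton] at hsum
    exact hb s hs hsum
  obtain ⟨w, hw⟩ := hy s hs t ht hst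
  refine ⟨s, hs, t, ht, w, hw, fun h0 => ?_⟩
  have hsplit := Finset.sum_filter_add_sum_filter_not F (fun t => y t w = 1) b
  have hsplit' := Finset.sum_filter_add_sum_filter_not F (fun t => y t w = 1)
    (fun t => b t * (y t w : ℤ))
  have e1 : ∑ t ∈ F.filter (fun t => y t w = 1), b t * (y t w : ℤ) =
      ∑ t ∈ F.filter (fun t => y t w = 1), b t :=
    Finset.sum_congr rfl fun t ht => by simp [(Finset.mem_filter.1 ht).2]
  have e2 : ∑ t ∈ F.filter (fun t => ¬ y t w = 1), b t * (y t w : ℤ) =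
      - ∑ t ∈ F.filter (fun t => ¬ y t w = 1), b t := by
    rw [← Finset.sum_neg_distrib]
    refine Finset.sum_congr rfl fun t ht => ?_
    rw [(Int.units_eq_one_or (y t w)).resolve_left (Finset.mem_filter.1 ht).2]
    simp
  have hcard := Finset.card_filter_add_card_filter_not (s := F) (fun t => y t w = 1)
  have hone : ∀ G : Finset ι, G ⊆ F → G.card = 1 → ∑ t ∈ G, b t ≠ 0 := by
    intro G hG h1
    obtain ⟨a, rfl⟩ := Finset.card_eq_one.1 h1
    rw [Finset.sum_singleton]
    exact hb a (hG (Finset.mem_singleton_self a))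
  have h1 := hone _ (Finset.filter_subset (fun t => y t w = 1) F)
  have h2 := hone _ (Finset.filter_subset (fun t => ¬ y t w = 1) F)
  have hpos : 0 < (F.filter (fun t => y t w = 1)).card ∧
      0 < (F.filter (fun t => ¬ y t w = 1)).card := by
    rw [Finset.card_pos, Finset.card_pos]
    by_cases hsw : y s w = 1
    · exact ⟨⟨s, by simp [hs, hsw]⟩, ⟨t, by simp only [Finset.mem_filter]; exact
        ⟨ht, fun h => hw (hsw.trans h.symm)⟩⟩⟩
    · refine ⟨⟨t, ?_⟩, ⟨s, by simp [hs, hsw]⟩⟩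
      simp only [Finset.mem_filter]
      refine ⟨ht, ?_⟩
      by_contra h
      rw [(Int.units_eq_one_or _).resolve_left h, (Int.units_eq_one_or _).resolve_left hsw] at hw
      exact hw rfl
  rcases (by omega : (F.filter (fun t => y t w = 1)).card = 1 ∨
      (F.filter (fun t => ¬ y t w = 1)).card = 1) with h | h
  · have := h1 h; omega
  · have := h2 h; omega

/-! ### Random colourings of the nodes -/

section Colourings

variable {ι : Type*}

/-- The restriction of the sign vector `y` to the nodes of colour `0` or `1`, padded by ones. -/
def testTrace {n : ℕ} (c : Fin n → Fin 4) (y : Fin n → ℤˣ) : Fin n → ℤˣ :=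
  fun w => if c w < 2 then y w else 1

/-- The rows of `I` whose partner `v t`, if there is one, has colour `3`. -/
def keptRows {n : ℕ} (I : Finset ι) (v : ι → Option (Fin n)) (c : Fin n → Fin 4) : Finset ι :=
  I.filter fun t => ∀ z, v t = some z → c z = 3

/-- The number of different test traces of the kept rows. -/
def traceCount {n : ℕ} (I : Finset ι) (x : ι → Fin n → ℤˣ) (v : ι → Option (Fin n))
    (c : Fin n → Fin 4) : ℕ :=
  ((keptRows I v c).image fun t => testTrace c (x t)).card

/-- The weight of a set of rows: a row whose partner is still to be coloured counts `1 / 16`. -/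
noncomputable def rowWeight {n : ℕ} (I : Finset ι) (v : ι → Option (Fin n)) : ℝ :=
  ∑ t ∈ I, if v t = none then (1 : ℝ) else 1 / 16

/-- The partner function on the nodes other than `0`; the partner `0` is forgotten. -/
def tailPartner {n : ℕ} (v : ι → Option (Fin (n + 1))) (t : ι) : Option (Fin n) :=
  (v t).bind fun z => Fin.cases none some z

lemma tailPartner_eq_some {n : ℕ} {v : ι → Option (Fin (n + 1))} {t : ι} {j : Fin n} :
    tailPartner v t = some j ↔ v t = some j.succ := by
  unfold tailPartner
  rcases hv : v t with _ | z
  · simp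
  · refine Fin.cases ?_ (fun i => ?_) z
    · simp [Fin.succ_ne_zero, eq_comm]
    · simp

lemma keptRows_tail_subset {n : ℕ} {I J : Finset ι} (hJ : J ⊆ I) {v : ι → Option (Fin (n + 1))}
    {c₀ : Fin 4} {c : Fin n → Fin 4} (h0 : ∀ t ∈ J, v t = some 0 → c₀ = 3) :
    keptRows J (tailPartner v) c ⊆ keptRows I v (Fin.cons c₀ c : Fin (n + 1) → Fin 4) := by
  intro t ht
  simp only [keptRows, Finset.mem_filter] at ht ⊢
  refine ⟨hJ ht.1, fun z => ?_⟩
  refine Fin.cases ?_ (fun j => ?_) z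
  · exact fun h => by simpa using h0 t ht.1 h
  · exact fun h => by simpa using ht.2 j (tailPartner_eq_some.2 h)

lemma tail_testTrace {n : ℕ} (c₀ : Fin 4) (c : Fin n → Fin 4) (y : Fin (n + 1) → ℤˣ) :
    Fin.tail (testTrace (Fin.cons c₀ c : Fin (n + 1) → Fin 4) y) = testTrace c (Fin.tail y) := by
  funext w
  simp [testTrace, Fin.tail]

lemma traceCount_tail_le_card {n : ℕ} (J : Finset ι) (x : ι → Fin (n + 1) → ℤˣ)
    (v : ι → Option (Fin (n + 1))) (c₀ : Fin 4) (c : Fin n → Fin 4) :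
    traceCount J (fun t => Fin.tail (x t)) (tailPartner v) c ≤
      ((keptRows J (tailPartner v) c).image
        fun t => testTrace (Fin.cons c₀ c : Fin (n + 1) → Fin 4) (x t)).card := by
  unfold traceCount
  simp_rw [← tail_testTrace c₀ c]
  exact (congrArg Finset.card (Finset.image_image (g := Fin.tail)
    (f := fun t => testTrace (Fin.cons c₀ c : Fin (n + 1) → Fin 4) (x t)))).symm.trans_le
    Finset.card_image_le

lemma traceCount_tail_le {n : ℕ} {I J : Finset ι} (hJ : J ⊆ I) (x : ι → Fin (n + 1) → ℤˣ)
    (v : ι → Option (Fin (n + 1))) {c₀ : Fin 4} (c : Fin n → Fin 4)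
    (h0 : ∀ t ∈ J, v t = some 0 → c₀ = 3) :
    traceCount J (fun t => Fin.tail (x t)) (tailPartner v) c ≤
      traceCount I x v (Fin.cons c₀ c : Fin (n + 1) → Fin 4) :=
  (traceCount_tail_le_card J x v c₀ c).trans
    (Finset.card_le_card (Finset.image_subset_image (keptRows_tail_subset hJ h0)))

lemma traceCount_tail_add_le {n : ℕ} {I J K : Finset ι} (hJ : J ⊆ I) (hK : K ⊆ I)
    (x : ι → Fin (n + 1) → ℤˣ) (v : ι → Option (Fin (n + 1))) {c₀ : Fin 4} (hc : c₀ < 2)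
    (c : Fin n → Fin 4) (hJ0 : ∀ t ∈ J, v t ≠ some 0) (hK0 : ∀ t ∈ K, v t ≠ some 0)
    (hJK : ∀ s ∈ J, ∀ t ∈ K, x s 0 ≠ x t 0) :
    traceCount J (fun t => Fin.tail (x t)) (tailPartner v) c +
      traceCount K (fun t => Fin.tail (x t)) (tailPartner v) c ≤
      traceCount I x v (Fin.cons c₀ c : Fin (n + 1) → Fin 4) := by
  refine (add_le_add (traceCount_tail_le_card J x v c₀ c)
    (traceCount_tail_le_card K x v c₀ c)).trans ?_
  rw [← Finset.card_union_of_disjoint]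
  · refine Finset.card_le_card (Finset.union_subset ?_ ?_) <;>
      refine Finset.image_subset_image (keptRows_tail_subset ?_ ?_)
    · exact hJ
    · exact fun t ht h => absurd h (hJ0 t ht)
    · exact hK
    · exact fun t ht h => absurd h (hK0 t ht)
  · rw [Finset.disjoint_left]
    intro y hy hy'
    obtain ⟨s, hs, rfl⟩ := Finset.mem_image.1 hy
    obtain ⟨t, ht, hst⟩ := Finset.mem_image.1 hy'
    have h := congrFun hst 0
    simp only [testTrace, Fin.cons_zero, hc, if_true] at h
    exact hJK s (Finset.mem_filter.1 hs).1 t (Finset.mem_filter.1 ht).1 h.symm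

variable [DecidableEq ι]

lemma sqrt_add_add_le {a b e : ℝ} (hb : 0 ≤ b) (hba : b ≤ a) (he : 0 ≤ e) :
    4 * √(a + b + e) ≤ 3 * √a + 2 * √b + √(a + 16 * e) := by
  have ha : 0 ≤ a := hb.trans hba
  have h1 := Real.sqrt_nonneg a
  have h2 := Real.sqrt_nonneg b
  have h3 := Real.sqrt_nonneg (a + 16 * e)
  have h4 := Real.sqrt_le_sqrt hba
  have h5 : √a ≤ √(a + 16 * e) := Real.sqrt_le_sqrt (by linarith)
  have e1 := Real.sq_sqrt ha
  have e2 := Real.sq_sqrt hb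
  have e3 := Real.sq_sqrt (by positivity : 0 ≤ a + 16 * e)
  have : √(a + b + e) ≤ (3 * √a + 2 * √b + √(a + 16 * e)) / 4 := by
    refine Real.sqrt_le_iff.2 ⟨by positivity, ?_⟩
    nlinarith [mul_nonneg h1 (sub_nonneg.2 h5), mul_nonneg h2 (sub_nonneg.2 h4),
      mul_nonneg h2 h3]
  linarith

/-- Colour the nodes uniformly at random. If any two rows differ at a node that is the partner of
neither, then the expected number of different test traces among the kept rows is at least the
square root of the weight of the rows. The colours are exposed one node at a time, and the
square root turns the two-way split of the rows at a test node into this gain. -/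
lemma sqrt_rowWeight_le_sum_traceCount (n : ℕ) :
    ∀ (I : Finset ι) (x : ι → Fin n → ℤˣ) (v : ι → Option (Fin n)),
      (∀ s ∈ I, ∀ t ∈ I, s ≠ t → ∃ w, v s ≠ some w ∧ v t ≠ some w ∧ x s w ≠ x t w) →
      4 ^ n * √(rowWeight I v) ≤ ∑ c : Fin n → Fin 4, (traceCount I x v c : ℝ) := by
  induction n with
  | zero =>
    intro I x v hI
    have hcard : I.card ≤ 1 := Finset.card_le_one.2 fun s hs t ht => by
      by_contra h
      obtain ⟨w, _⟩ := hI s hs t ht h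
      exact w.elim0
    have hv : ∀ t, v t = none := fun t => by
      rcases h : v t with _ | z
      · rfl
      · exact z.elim0
    have hk : ∀ c, traceCount I x v c = I.card := by
      intro c
      have : keptRows I v c = I := Finset.filter_true_of_mem fun t _ z => z.elim0
      rw [traceCount, this]
      refine Finset.card_image_of_injOn fun s hs t ht _ => Finset.card_le_one.1 hcard s hs t ht
    simp only [hk, rowWeight, hv]
    rcases (by omega : I.card = 0 ∨ I.card = 1) with h | h <;> simp [h]
  | succ n ih =>
    intro I x v hI
    have key : ∀ A B : Finset ι, A ⊆ I → B ⊆ I → (∀ t ∈ A, v t ≠ some 0) →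
        (∀ t ∈ B, v t ≠ some 0) → (∀ s ∈ A, ∀ t ∈ B, x s 0 ≠ x t 0) →
        (∀ s ∈ A, ∀ t ∈ A, x s 0 = x t 0) → (∀ s ∈ B, ∀ t ∈ B, x s 0 = x t 0) →
        rowWeight I v = rowWeight A v + rowWeight B v +
          ((I.filter fun t => v t = some 0).card : ℝ) / 16 →
        rowWeight B v ≤ rowWeight A v →
        4 ^ (n + 1) * √(rowWeight I v) ≤
          ∑ c : Fin (n + 1) → Fin 4, (traceCount I x v c : ℝ) := by
      intro A B hA hB hA0 hB0 hAB hAA hBB hw hle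
      set E := I.filter fun t => v t = some 0 with hE
      have hEI : E ⊆ I := Finset.filter_subset _ _
      have hAE : A ∪ E ⊆ I := Finset.union_subset hA hEI
      have hpair : ∀ J ⊆ I, (∀ s ∈ J, ∀ t ∈ J, v s = some 0 ∨ v t = some 0 ∨ x s 0 = x t 0) →
          ∀ s ∈ J, ∀ t ∈ J, s ≠ t → ∃ w, tailPartner v s ≠ some w ∧ tailPartner v t ≠ some w ∧
            Fin.tail (x s) w ≠ Fin.tail (x t) w := by
        intro J hJ h s hs t ht hst
        obtain ⟨w, h1, h2, h3⟩ := hI s (hJ hs) t (hJ ht) hst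
        have hw0 : w ≠ 0 := by
          rintro rfl
          rcases h s hs t ht with h | h | h
          · exact h1 h
          · exact h2 h
          · exact h3 h
        obtain ⟨j, rfl⟩ := Fin.exists_succ_eq.2 hw0
        exact ⟨j, fun h => h1 (tailPartner_eq_some.1 h), fun h => h2 (tailPartner_eq_some.1 h), h3⟩
      have iA := ih A (fun t => Fin.tail (x t)) (tailPartner v)
        (hpair A hA fun s hs t ht => Or.inr (Or.inr (hAA s hs t ht)))
      have iB := ih B (fun t => Fin.tail (x t)) (tailPartner v)
        (hpair B hB fun s hs t ht => Or.inr (Or.inr (hBB s hs t ht)))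
      have iE := ih (A ∪ E) (fun t => Fin.tail (x t)) (tailPartner v)
        (hpair (A ∪ E) hAE fun s hs t ht => by
          rcases Finset.mem_union.1 hs with hs | hs
          · rcases Finset.mem_union.1 ht with ht | ht
            · exact Or.inr (Or.inr (hAA s hs t ht))
            · exact Or.inr (Or.inl (Finset.mem_filter.1 ht).2)
          · exact Or.inl (Finset.mem_filter.1 hs).2)
      have hnone : ∀ t, v t ≠ some 0 → (tailPartner v t = none ↔ v t = none) := by
        intro t ht
        rcases hv : v t with _ | z
        · simp [tailPartner, hv]
        · rw [hv] at ht
          obtain ⟨j, rfl⟩ := Fin.exists_succ_eq.2 (fun h : z = 0 => ht (by rw [h]))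
          simp [tailPartner, hv]
      have hwt : ∀ J : Finset ι, (∀ t ∈ J, v t ≠ some 0) →
          rowWeight J (tailPartner v) = rowWeight J v := fun J hJ =>
        Finset.sum_congr rfl fun t ht => by simp only [hnone t (hJ t ht)]
      have hwE : rowWeight (A ∪ E) (tailPartner v) = rowWeight A v + 16 * ((E.card : ℝ) / 16) := by
        have hd : Disjoint A E := Finset.disjoint_left.2 fun t ht ht' =>
          hA0 t ht (Finset.mem_filter.1 ht').2
        have h1 : rowWeight E (tailPartner v) = E.card := by
          rw [rowWeight, Finset.sum_congr rfl (g := fun _ => (1 : ℝ))]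
          · simp
          · intro t ht
            simp [tailPartner, (Finset.mem_filter.1 ht).2]
        rw [← hwt A hA0, mul_div_cancel₀ _ (by norm_num : (16 : ℝ) ≠ 0), ← h1]
        exact Finset.sum_union hd
      rw [hwt A hA0] at iA
      rw [hwt B hB0] at iB
      rw [hwE] at iE
      have hnn : ∀ J : Finset ι, 0 ≤ rowWeight J v := fun J =>
        Finset.sum_nonneg fun t _ => by split_ifs <;> norm_num
      have hsq := sqrt_add_add_le (hnn B) hle (by positivity : 0 ≤ (E.card : ℝ) / 16)
      rw [← hw] at hsq
      rw [← (Fin.consEquiv fun _ : Fin (n + 1) => Fin 4).sum_comp, Fintype.sum_prod_type_right]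
      -- If node `0` is a test node, then the traces of `A` and `B` are kept apart. If it is a mover,
      -- then `A` alone is counted. If it is a partner, then the rows `E` join `A`.
      have hstep : ∀ c : Fin n → Fin 4,
          3 * (traceCount A (fun t => Fin.tail (x t)) (tailPartner v) c : ℝ) +
            2 * (traceCount B (fun t => Fin.tail (x t)) (tailPartner v) c : ℝ) +
            (traceCount (A ∪ E) (fun t => Fin.tail (x t)) (tailPartner v) c : ℝ) ≤
          ∑ c₀ : Fin 4, (traceCount I x v
            ((Fin.consEquiv fun _ : Fin (n + 1) => Fin 4) (c₀, c)) : ℝ) := by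
        intro c
        have h0 := traceCount_tail_add_le hA hB x v (c₀ := 0) (by decide) c hA0 hB0 hAB
        have h1 := traceCount_tail_add_le hA hB x v (c₀ := 1) (by decide) c hA0 hB0 hAB
        have h2 := traceCount_tail_le hA x v (c₀ := 2) c fun t ht h => absurd h (hA0 t ht)
        have h3 := traceCount_tail_le hAE x v (c₀ := 3) c fun t ht h => rfl
        rw [Fin.sum_univ_four]
        simp only [Fin.consEquiv, Equiv.coe_fn_mk]
        exact_mod_cast (by omega)
      refine le_trans ?_ (Finset.sum_le_sum fun c _ => hstep c)
      rw [Finset.sum_add_distrib, Finset.sum_add_distrib, ← Finset.mul_sum, ← Finset.mul_sum]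
      calc 4 ^ (n + 1) * √(rowWeight I v) = 4 ^ n * (4 * √(rowWeight I v)) := by ring
        _ ≤ 4 ^ n * (3 * √(rowWeight A v) + 2 * √(rowWeight B v) +
            √(rowWeight A v + 16 * ((E.card : ℝ) / 16))) := by gcongr
        _ ≤ _ := by linarith
    set A := I.filter fun t => v t ≠ some 0 ∧ x t 0 = 1 with hA
    set B := I.filter fun t => v t ≠ some 0 ∧ x t 0 ≠ 1 with hB
    have hneg : ∀ t ∈ B, x t 0 = -1 := fun t ht =>
      (Int.units_eq_one_or _).resolve_left (Finset.mem_filter.1 ht).2.2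
    have hpos : ∀ t ∈ A, x t 0 = 1 := fun t ht => (Finset.mem_filter.1 ht).2.2
    have hw : rowWeight I v = rowWeight A v + rowWeight B v +
        ((I.filter fun t => v t = some 0).card : ℝ) / 16 := by
      have h1 : (((I.filter fun t => v t = some 0).card : ℝ)) / 16 =
          ∑ t ∈ I.filter fun t => v t = some 0, (if v t = none then (1 : ℝ) else 1 / 16) := by
        rw [Finset.sum_congr rfl (g := fun _ => (1 / 16 : ℝ))]
        · simp [div_eq_mul_inv]
        · intro t ht
          simp [(Finset.mem_filter.1 ht).2]
      rw [h1, hA, hB]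
      simp only [rowWeight, Finset.sum_filter, ← Finset.sum_add_distrib]
      refine Finset.sum_congr rfl fun t _ => ?_
      by_cases h0 : v t = some 0 <;> by_cases h1 : x t 0 = 1 <;> simp [h0, h1]
    have hA0 : ∀ t ∈ A, v t ≠ some 0 := fun t ht => (Finset.mem_filter.1 ht).2.1
    have hB0 : ∀ t ∈ B, v t ≠ some 0 := fun t ht => (Finset.mem_filter.1 ht).2.1
    have hAA : ∀ s ∈ A, ∀ t ∈ A, x s 0 = x t 0 := fun s hs t ht => by rw [hpos s hs, hpos t ht]
    have hBB : ∀ s ∈ B, ∀ t ∈ B, x s 0 = x t 0 := fun s hs t ht => by rw [hneg s hs, hneg t ht]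
    have hAB : ∀ s ∈ A, ∀ t ∈ B, x s 0 ≠ x t 0 := fun s hs t ht => by
      rw [hpos s hs, hneg t ht]; decide
    rcases le_total (rowWeight B v) (rowWeight A v) with h | h
    · exact key A B (Finset.filter_subset _ _) (Finset.filter_subset _ _) hA0 hB0 hAB hAA hBB hw h
    · exact key B A (Finset.filter_subset _ _) (Finset.filter_subset _ _) hB0 hA0
        (fun s hs t ht => (hAB t ht s hs).symm) hBB hAA (by rw [hw]; ring) h

omit [DecidableEq ι] in
lemma traceCount_le_of_eq_off {n : ℕ} (I : Finset ι) (x : ι → Fin n → ℤˣ)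
    (v : ι → Option (Fin n)) (z : Fin n) (hv : ∀ t ∈ I, v t ≠ some z) (a : ℤˣ)
    (hx : ∀ t ∈ I, x t z = a) {c c' : Fin n → Fin 4} (hc : ∀ w, w ≠ z → c w = c' w) :
    traceCount I x v c ≤ traceCount I x v c' := by
  have hk : keptRows I v c = keptRows I v c' := by
    refine Finset.filter_congr fun t ht => forall₂_congr fun w hw => ?_
    rw [hc w (fun h => hv t ht (by rw [hw, h]))]
  unfold traceCount
  rw [hk]
  have himg : (keptRows I v c').image (fun t => testTrace c (x t)) =
      ((keptRows I v c').image fun t => testTrace c' (x t)).image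
        fun y => Function.update y z (if c z < 2 then a else 1) := by
    rw [Finset.image_image]
    refine Finset.image_congr fun t ht => ?_
    funext w
    by_cases hw : w = z
    · subst hw
      simp [testTrace, hx t (Finset.mem_filter.1 (Finset.mem_coe.1 ht)).1]
    · simp [testTrace, hw, hc w hw]
  rw [himg]
  exact Finset.card_image_le

lemma sum_update_le {n : ℕ} (z : Fin n) (N : (Fin n → Fin 4) → ℝ) (hN : ∀ c, 0 ≤ N c)
    (h : ∀ c, N c ≤ N (Function.update c z 2)) :
    ∑ c, N c ≤ 4 * ∑ c, if c z = 2 then N c else 0 := by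
  refine (Finset.sum_le_sum fun c _ => h c).trans ?_
  rw [← Finset.sum_filter, Finset.mul_sum,
    ← Finset.sum_fiberwise_of_maps_to (s := Finset.univ)
      (t := Finset.univ.filter fun c : Fin n → Fin 4 => c z = 2)
      (g := fun c => Function.update c z 2) (by intro c _; simp)]
  refine Finset.sum_le_sum fun c _ => ?_
  have h1 : ∀ c' ∈ Finset.univ.filter fun c' : Fin n → Fin 4 => Function.update c' z 2 = c,
      N (Function.update c' z 2) = N c := fun c' hc' => by rw [(Finset.mem_filter.1 hc').2]
  rw [Finset.sum_congr rfl h1, Finset.sum_const, nsmul_eq_mul]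
  refine mul_le_mul_of_nonneg_right ?_ (hN c)
  have h2 : (Finset.univ.filter fun c' : Fin n → Fin 4 => Function.update c' z 2 = c).card ≤
      (Finset.univ : Finset (Fin 4)).card := by
    refine Finset.card_le_card_of_injOn (fun c' => c' z) (fun _ _ => Finset.mem_coe.2
      (Finset.mem_univ _)) ?_
    intro a ha b hb hab
    simp only [Finset.coe_filter, Finset.mem_univ, true_and, Set.mem_ofPred_eq] at ha hb
    funext w
    by_cases hw : w = z
    · subst hw; exact hab
    · have := congrFun (ha.trans hb.symm) w
      simpa [hw] using this
  exact_mod_cast h2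

/-- There is a colouring of the nodes for which many rows have a mover `u t` of colour `2`, a
partner of colour `3`, and are told apart from the other such rows with the same mover by a node of
colour `0` or `1`. -/
lemma exists_colouring {n : ℕ} (T : Finset ι) (u : ι → Fin n) (v : ι → Option (Fin n))
    (x : ι → Fin n → ℤˣ) (D : ℕ) (hD : ∀ z, (T.filter fun t => u t = z).card ≤ D)
    (huv : ∀ t ∈ T, v t ≠ some (u t)) (σ : Fin n → ℤˣ) (hσ : ∀ t ∈ T, x t (u t) = σ (u t))
    (hpair : ∀ s ∈ T, ∀ t ∈ T, s ≠ t → u s = u t →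
      ∃ w, v s ≠ some w ∧ v t ≠ some w ∧ x s w ≠ x t w) :
    ∃ (c : Fin n → Fin 4) (T' : Finset ι), T' ⊆ T ∧
      (∀ t ∈ T', c (u t) = 2 ∧ ∀ z, v t = some z → c z = 3) ∧
      (∀ s ∈ T', ∀ t ∈ T', s ≠ t → u s = u t → ∃ w, c w < 2 ∧ x s w ≠ x t w) ∧
      (T.card : ℝ) ≤ 16 * √D * T'.card := by
  set I : Fin n → Finset ι := fun z => T.filter fun t => u t = z with hI
  have hIT : ∀ z, ∀ t ∈ I z, t ∈ T ∧ u t = z := fun z t ht => Finset.mem_filter.1 ht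
  have hTsum : (T.card : ℝ) = ∑ z, ((I z).card : ℝ) := by
    exact_mod_cast Finset.card_eq_sum_card_fiberwise (s := T) (f := u) (t := Finset.univ)
      (fun _ _ => Finset.mem_coe.2 (Finset.mem_univ _))
  have hz : ∀ z, 4 ^ n * ((I z).card : ℝ) ≤
      16 * √D * ∑ c : Fin n → Fin 4, if c z = 2 then (traceCount (I z) x v c : ℝ) else 0 := by
    intro z
    have h1 := sqrt_rowWeight_le_sum_traceCount n (I z) x v fun s hs t ht hst =>
      hpair s (hIT z s hs).1 t (hIT z t ht).1 hst ((hIT z s hs).2.trans (hIT z t ht).2.symm)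
    have h2 := sum_update_le z (fun c => (traceCount (I z) x v c : ℝ)) (fun c => by positivity)
      fun c => by
        exact_mod_cast traceCount_le_of_eq_off (I z) x v z
          (fun t ht => by have := huv t (hIT z t ht).1; rwa [(hIT z t ht).2] at this) (σ z)
          (fun t ht => by have := hσ t (hIT z t ht).1; rwa [(hIT z t ht).2] at this)
          fun w hw => by simp [hw]
    have h3 : ((I z).card : ℝ) / 16 ≤ rowWeight (I z) v := by
      rw [rowWeight, div_eq_mul_inv, ← nsmul_eq_mul]
      refine Finset.card_nsmul_le_sum _ _ _ fun t _ => ?_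
      split_ifs <;> norm_num
    have h4 : √((I z).card : ℝ) / 4 ≤ √(rowWeight (I z) v) := by
      refine le_trans (le_of_eq ?_) (Real.sqrt_le_sqrt h3)
      rw [Real.sqrt_div' _ (by norm_num), show (16 : ℝ) = 4 ^ 2 by norm_num,
        Real.sqrt_sq (by norm_num)]
    have h5 : ((I z).card : ℝ) ≤ √D * √((I z).card : ℝ) := by
      have h6 : √((I z).card : ℝ) ≤ √D := Real.sqrt_le_sqrt (by exact_mod_cast hD z)
      calc ((I z).card : ℝ) = √((I z).card : ℝ) * √((I z).card : ℝ) :=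
            (Real.mul_self_sqrt (by positivity)).symm
        _ ≤ _ := by gcongr
    set M := ∑ c : Fin n → Fin 4, if c z = 2 then (traceCount (I z) x v c : ℝ) else 0
    calc 4 ^ n * ((I z).card : ℝ) ≤ 4 ^ n * (√D * √((I z).card : ℝ)) := by gcongr
      _ = 4 * √D * (4 ^ n * (√((I z).card : ℝ) / 4)) := by ring
      _ ≤ 4 * √D * (4 ^ n * √(rowWeight (I z) v)) := by gcongr
      _ ≤ 4 * √D * (4 * M) := mul_le_mul_of_nonneg_left (h1.trans h2) (by positivity)
      _ = 16 * √D * M := by ring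
  obtain ⟨c, -, hc⟩ : ∃ c ∈ (Finset.univ : Finset (Fin n → Fin 4)), (T.card : ℝ) ≤
      16 * √D * ∑ z, if c z = 2 then (traceCount (I z) x v c : ℝ) else 0 := by
    refine Finset.exists_le_of_sum_le Finset.univ_nonempty ?_
    rw [← Finset.mul_sum, Finset.sum_comm, Finset.mul_sum, hTsum, Finset.sum_const, nsmul_eq_mul,
      Finset.mul_sum]
    refine Finset.sum_le_sum fun z _ => ?_
    have : ((Finset.univ : Finset (Fin n → Fin 4)).card : ℝ) = 4 ^ n := by simp
    rw [this]
    exact hz z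
  have hR : ∀ z, ∃ R ⊆ keptRows (I z) v c, Set.InjOn (fun t => testTrace c (x t)) (R : Set ι) ∧
      R.card = traceCount (I z) x v c := by
    intro z
    obtain ⟨R, h1, h2, h3⟩ := Finset.exists_subset_injOn_image_eq_of_surjOn
      (f := fun t => testTrace c (x t)) (keptRows (I z) v c)
      ((keptRows (I z) v c).image fun t => testTrace c (x t)) (by
        rw [Finset.coe_image]; exact Set.surjOn_image _ _)
    refine ⟨R, by exact_mod_cast h1, h2, ?_⟩
    rw [traceCount, ← h3, Finset.card_image_of_injOn h2]
  choose R hR1 hR2 hR3 using hR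
  have hRI : ∀ z, ∀ t ∈ R z, t ∈ T ∧ u t = z ∧ ∀ w, v t = some w → c w = 3 := by
    intro z t ht
    have := Finset.mem_filter.1 (hR1 z ht)
    exact ⟨(hIT z t this.1).1, (hIT z t this.1).2, this.2⟩
  refine ⟨c, (Finset.univ.filter fun z => c z = 2).biUnion R, ?_, ?_, ?_, ?_⟩
  · intro t ht
    obtain ⟨z, _, htz⟩ := Finset.mem_biUnion.1 ht
    exact (hRI z t htz).1
  · intro t ht
    obtain ⟨z, hz2, htz⟩ := Finset.mem_biUnion.1 ht
    refine ⟨?_, (hRI z t htz).2.2⟩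
    rw [(hRI z t htz).2.1]
    exact (Finset.mem_filter.1 hz2).2
  · intro s hs t ht hst hust
    obtain ⟨z, _, hsz⟩ := Finset.mem_biUnion.1 hs
    obtain ⟨z', _, htz⟩ := Finset.mem_biUnion.1 ht
    obtain rfl : z = z' := by rw [← (hRI z s hsz).2.1, ← (hRI z' t htz).2.1, hust]
    by_contra! hall
    refine hst (hR2 z (Finset.mem_coe.2 hsz) (Finset.mem_coe.2 htz) ?_)
    funext w
    simp only [testTrace]
    split_ifs with hw
    · exact hall w hw
    · rfl
  · rw [Finset.card_biUnion]
    · push_cast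
      rw [Finset.sum_filter]
      simpa only [hR3] using hc
    · intro z _ z' _ hzz'
      refine Finset.disjoint_left.2 fun t ht ht' => hzz' ?_
      rw [← (hRI z t ht).2.1, ← (hRI z' t ht').2.1]

end Colourings

/-! ### Windows in which many moves have a light node -/

section Windows

variable {V : Type*} [DecidableEq V]

/-- The number of times `t < N` in the `j`-th window of length `2 ^ k` at which the node `z`
moves, where `e t` is the set of the nodes that move at time `t`. -/
def windowDegree (e : ℕ → Finset V) (N k j : ℕ) (z : V) : ℕ :=
  ((Finset.range N).filter fun t => t / 2 ^ k = j ∧ z ∈ e t).card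

lemma sum_card_filter_mem_le [Fintype V] (e : ℕ → Finset V) (W : Finset ℕ)
    (he : ∀ t ∈ W, (e t).card ≤ 2) :
    ∑ z, (W.filter fun t => z ∈ e t).card ≤ 2 * W.card := by
  calc ∑ z, (W.filter fun t => z ∈ e t).card
      = ∑ t ∈ W, (e t).card := by
        simp only [Finset.card_filter]
        rw [Finset.sum_comm]
        refine Finset.sum_congr rfl fun t _ => ?_
        rw [← Finset.card_filter]
        congr 1
        ext z
        simp
    _ ≤ ∑ t ∈ W, 2 := Finset.sum_le_sum he
    _ = 2 * W.card := by simp [mul_comm]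

/-- A node is rarely busy in a window of length `2 ^ (k + 1)` and at the same time almost idle in
the half of this window that contains the current move. -/
lemma card_sparse_half_le (e : ℕ → Finset V) (N k d D : ℕ) (z : V) :
    D * ((Finset.range N).filter fun t => z ∈ e t ∧
        D ≤ windowDegree e N (k + 1) (t / 2 ^ (k + 1)) z ∧
        windowDegree e N k (t / 2 ^ k) z < d).card ≤
      2 * d * ((Finset.range N).filter fun t => z ∈ e t).card := by
  set B := (Finset.range N).filter fun t => z ∈ e t ∧
        D ≤ windowDegree e N (k + 1) (t / 2 ^ (k + 1)) z ∧
        windowDegree e N k (t / 2 ^ k) z < d with hB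
  set J := B.image fun t => t / 2 ^ (k + 1) with hJ
  have h1 : B.card ≤ J.card * (2 * d) := by
    rw [Finset.card_eq_sum_card_image (fun t => t / 2 ^ (k + 1)) B, ← smul_eq_mul]
    refine Finset.sum_le_card_nsmul _ _ _ fun j _ => ?_
    have hhalf : ∀ i, (B.filter fun t => t / 2 ^ k = i).card ≤ d := by
      intro i
      rcases (B.filter fun t => t / 2 ^ k = i).eq_empty_or_nonempty with h | ⟨s, hs⟩
      · simp [h]
      · obtain ⟨hsB, hsi⟩ := Finset.mem_filter.1 hs
        have hlt := (Finset.mem_filter.1 hsB).2.2.2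
        rw [hsi] at hlt
        refine le_trans (Finset.card_le_card ?_) hlt.le
        intro t ht
        simp only [hB, Finset.mem_filter] at ht ⊢
        exact ⟨ht.1.1, ht.2, ht.1.2.1⟩
    have hcover : (B.filter fun t => t / 2 ^ (k + 1) = j) ⊆
        (B.filter fun t => t / 2 ^ k = 2 * j) ∪ (B.filter fun t => t / 2 ^ k = 2 * j + 1) := by
      intro t ht
      simp only [Finset.mem_filter, Finset.mem_union] at ht ⊢
      have h := ht.2
      rw [pow_succ, ← Nat.div_div_eq_div_mul] at h
      rcases (by omega : t / 2 ^ k = 2 * j ∨ t / 2 ^ k = 2 * j + 1) with h' | h'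
      · exact Or.inl ⟨ht.1, h'⟩
      · exact Or.inr ⟨ht.1, h'⟩
    have h2 := (Finset.card_le_card hcover).trans (Finset.card_union_le _ _)
    have h3 := hhalf (2 * j)
    have h4 := hhalf (2 * j + 1)
    omega
  have h2 : J.card * D ≤ ((Finset.range N).filter fun t => z ∈ e t).card := by
    refine le_trans ?_ (sum_card_fiber_le _ J fun t => t / 2 ^ (k + 1))
    rw [← smul_eq_mul]
    refine Finset.card_nsmul_le_sum _ _ _ fun j hj => ?_
    obtain ⟨s, hs, rfl⟩ := Finset.mem_image.1 hj
    refine (Finset.mem_filter.1 hs).2.2.1.trans (Finset.card_le_card ?_)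
    intro t ht
    simp only [Finset.mem_filter] at ht ⊢
    exact ⟨⟨ht.1, ht.2.2⟩, ht.2.1⟩
  calc D * B.card ≤ D * (J.card * (2 * d)) := by gcongr
    _ = 2 * d * (J.card * D) := by ring
    _ ≤ _ := by gcongr

/-- Some dyadic window contains many moves such that each moving node moves at least `d` times in
the window, and one of them less than `D` times. For most moves, this holds at the largest scale at
which some moving node is light, since a node does not often become heavy abruptly. -/
lemma exists_good_window [Fintype V] (e : ℕ → Finset V) (κ d D : ℕ) (hκ : 0 < κ) (hd : 0 < d)
    (he : ∀ t < 2 ^ κ, (e t).card ≤ 2) (he' : ∀ t < 2 ^ κ, (e t).Nonempty)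
    (hD : 16 * κ * d ≤ D)
    (hN : 4 * (Fintype.card V * D) ≤ 2 ^ κ) :
    ∃ k < κ, ∃ j < 2 ^ (κ - k), 2 ^ k ≤ 2 * κ * ((Finset.range (2 ^ κ)).filter fun t =>
      t / 2 ^ k = j ∧ (∀ z ∈ e t, d ≤ windowDegree e (2 ^ κ) k j z) ∧
        ∃ z ∈ e t, windowDegree e (2 ^ κ) k j z < D).card := by
  set N := 2 ^ κ with hNdef
  have hD2 : 2 ≤ D := by nlinarith [Nat.mul_pos hκ hd]
  -- `lost`: some node is light already in the whole run; `bad`: some node turns from heavy to almost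
  -- idle when the scale is halved; `G k`: the moves that are good at scale `k`.
  set lost := (Finset.range N).filter fun t => ∃ z ∈ e t, windowDegree e N κ 0 z < D with hlost
  set bad := (Finset.range N).filter fun t => ∃ k < κ, ∃ z ∈ e t,
    D ≤ windowDegree e N (k + 1) (t / 2 ^ (k + 1)) z ∧ windowDegree e N k (t / 2 ^ k) z < d
    with hbad
  set G : ℕ → Finset ℕ := fun k => (Finset.range N).filter fun t =>
    (∀ z ∈ e t, d ≤ windowDegree e N k (t / 2 ^ k) z) ∧
      ∃ z ∈ e t, windowDegree e N k (t / 2 ^ k) z < D with hG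
  have hlostcard : 4 * lost.card ≤ N := by
    have h1 : lost ⊆ (Finset.univ.filter fun z => windowDegree e N κ 0 z < D).biUnion fun z =>
        (Finset.range N).filter fun t => t / 2 ^ κ = 0 ∧ z ∈ e t := by
      intro t ht
      simp only [hlost, Finset.mem_filter, Finset.mem_biUnion, Finset.mem_univ, true_and] at ht ⊢
      obtain ⟨htN, z, hz, hzD⟩ := ht
      exact ⟨z, hzD, htN, Nat.div_eq_of_lt (Finset.mem_range.1 htN), hz⟩
    have h2 := (Finset.card_le_card h1).trans (Finset.card_biUnion_le_card_mul _ _ D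
      fun z hz => (Finset.mem_filter.1 hz).2.le)
    have h3 : (Finset.univ.filter fun z => windowDegree e N κ 0 z < D).card * D ≤
        Fintype.card V * D := Nat.mul_le_mul_right _ (Finset.card_le_univ _)
    omega
  have hbadcard : 4 * bad.card ≤ N := by
    have h1 : bad ⊆ (Finset.range κ).biUnion fun k => Finset.univ.biUnion fun z =>
        (Finset.range N).filter fun t => z ∈ e t ∧
        D ≤ windowDegree e N (k + 1) (t / 2 ^ (k + 1)) z ∧
        windowDegree e N k (t / 2 ^ k) z < d := by
      intro t ht
      simp only [hbad, Finset.mem_filter, Finset.mem_biUnion, Finset.mem_univ, true_and,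
        Finset.mem_range] at ht ⊢
      obtain ⟨htN, k, hk, z, h⟩ := ht
      exact ⟨k, hk, z, htN, h⟩
    have h2 : D * bad.card ≤ κ * (2 * d * (2 * N)) := by
      calc D * bad.card ≤ D * ∑ k ∈ Finset.range κ, ∑ z, ((Finset.range N).filter fun t =>
            z ∈ e t ∧ D ≤ windowDegree e N (k + 1) (t / 2 ^ (k + 1)) z ∧
            windowDegree e N k (t / 2 ^ k) z < d).card := by
            gcongr
            refine (Finset.card_le_card h1).trans (Finset.card_biUnion_le.trans ?_)
            exact Finset.sum_le_sum fun k _ => Finset.card_biUnion_le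
        _ = ∑ k ∈ Finset.range κ, ∑ z, D * ((Finset.range N).filter fun t =>
            z ∈ e t ∧ D ≤ windowDegree e N (k + 1) (t / 2 ^ (k + 1)) z ∧
            windowDegree e N k (t / 2 ^ k) z < d).card := by
            simp only [Finset.mul_sum]
        _ ≤ ∑ k ∈ Finset.range κ, ∑ z,
            2 * d * ((Finset.range N).filter fun t => z ∈ e t).card :=
            Finset.sum_le_sum fun k _ => Finset.sum_le_sum fun z _ =>
              card_sparse_half_le e N k d D z
        _ ≤ ∑ k ∈ Finset.range κ, 2 * d * (2 * N) := by
            refine Finset.sum_le_sum fun k _ => ?_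
            rw [← Finset.mul_sum]
            have := sum_card_filter_mem_le e (Finset.range N) fun t ht => he t (Finset.mem_range.1 ht)
            rw [Finset.card_range] at this
            exact Nat.mul_le_mul_left _ this
        _ = κ * (2 * d * (2 * N)) := by simp
    have h3 : (16 * κ * d) * bad.card ≤ D * bad.card := Nat.mul_le_mul_right _ hD
    have h4 : (4 * (κ * d)) * (4 * bad.card) ≤ (4 * (κ * d)) * N := by nlinarith
    exact Nat.le_of_mul_le_mul_left h4 (by positivity)
  have hcover : Finset.range N ⊆ (lost ∪ bad) ∪ (Finset.range κ).biUnion G := by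
    intro t ht
    by_contra hcon
    simp only [Finset.mem_union, not_or, Finset.mem_biUnion, not_exists, not_and] at hcon
    obtain ⟨⟨hl, hb⟩, hg⟩ := hcon
    have htN := Finset.mem_range.1 ht
    simp only [hlost, hbad, Finset.mem_filter, ht, true_and, not_exists, not_and, not_lt] at hl hb
    have hex : ∃ k, ∀ z ∈ e t, D ≤ windowDegree e N k (t / 2 ^ k) z :=
      ⟨κ, fun z hz => by rw [Nat.div_eq_of_lt htN]; exact hl z hz⟩
    have hκle : Nat.find hex ≤ κ :=
      Nat.find_le fun z hz => by rw [Nat.div_eq_of_lt htN]; exact hl z hz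
    have hne : Nat.find hex ≠ 0 := by
      intro h0
      have h := Nat.find_spec hex
      rw [h0] at h
      obtain ⟨z, hz⟩ := he' t htN
      have h1 := h z hz
      have h2 : windowDegree e N 0 (t / 2 ^ 0) z ≤ 1 := by
        refine Finset.card_le_one.2 fun a ha b hb => ?_
        have ha' := (Finset.mem_filter.1 ha).2.1
        have hb' := (Finset.mem_filter.1 hb).2.1
        simp only [pow_zero, Nat.div_one] at ha' hb'
        rw [ha', hb']
      omega
    obtain ⟨k, hk⟩ := Nat.exists_eq_succ_of_ne_zero hne
    have hspec := Nat.find_spec hex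
    rw [hk] at hspec
    have hmin := Nat.find_min hex (m := k) (by omega)
    push Not at hmin
    refine hg k (Finset.mem_range.2 (by omega)) ?_
    simp only [hG, Finset.mem_filter, ht, true_and]
    exact ⟨fun z hz => hb k (by omega) z hz (hspec z hz), hmin⟩
  by_contra! hcon
  have hGk : ∀ k ∈ Finset.range κ, 2 * κ * (G k).card + 1 ≤ N := by
    intro k hk
    have hkκ := Finset.mem_range.1 hk
    have hNk : N = 2 ^ (κ - k) * 2 ^ k := by rw [hNdef, ← pow_add]; congr 1; omega
    have hmaps : Set.MapsTo (fun t => t / 2 ^ k) (G k : Set ℕ)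
        (Finset.range (2 ^ (κ - k)) : Finset ℕ) := by
      intro t ht
      have := Finset.mem_range.1 (Finset.mem_filter.1 (Finset.mem_coe.1 ht)).1
      rw [hNk] at this
      exact Finset.mem_coe.2 (Finset.mem_range.2 (Nat.div_lt_of_lt_mul (by rwa [mul_comm])))
    have h1 := Finset.card_eq_sum_card_fiberwise hmaps
    have h2 : ∑ j ∈ Finset.range (2 ^ (κ - k)),
        (2 * κ * ((G k).filter fun t => t / 2 ^ k = j).card + 1) ≤
        ∑ j ∈ Finset.range (2 ^ (κ - k)), 2 ^ k := by
      refine Finset.sum_le_sum fun j hj => ?_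
      refine le_trans (Nat.succ_le_succ (Nat.mul_le_mul_left _ (Finset.card_le_card ?_)))
        (hcon k hkκ j (Finset.mem_range.1 hj))
      intro t ht
      simp only [hG, Finset.mem_filter] at ht ⊢
      obtain ⟨⟨h1, h2, h3⟩, rfl⟩ := ht
      exact ⟨h1, rfl, h2, h3⟩
    rw [Finset.sum_add_distrib, ← Finset.mul_sum, ← h1] at h2
    simp only [Finset.sum_const, Finset.card_range, smul_eq_mul, mul_one] at h2
    rw [← hNk] at h2
    have := Nat.one_le_two_pow (n := κ - k)
    omega
  have h1 := Finset.card_le_card hcover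
  have h2 := Finset.card_union_le (lost ∪ bad) ((Finset.range κ).biUnion G)
  have h3 := Finset.card_union_le lost bad
  have h4 : ((Finset.range κ).biUnion G).card ≤ ∑ k ∈ Finset.range κ, (G k).card :=
    Finset.card_biUnion_le
  have h5 : 2 * κ * ∑ k ∈ Finset.range κ, (G k).card + κ ≤ κ * N := by
    calc 2 * κ * ∑ k ∈ Finset.range κ, (G k).card + κ
        = ∑ k ∈ Finset.range κ, (2 * κ * (G k).card + 1) := by
          rw [Finset.sum_add_distrib, ← Finset.mul_sum]; simp
      _ ≤ ∑ k ∈ Finset.range κ, N := Finset.sum_le_sum hGk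
      _ = κ * N := by simp
  rw [Finset.card_range] at h1
  have h6 : N ≤ 2 * ∑ k ∈ Finset.range κ, (G k).card := by omega
  nlinarith [Nat.mul_le_mul_left κ h6]

end Windows

/-! ### Runs and their certificates -/

section Certificates

variable {n : ℕ}

/-- The set of the nodes whose sign changes from time `t` to time `t + 1`. -/
def movedSet (x : ℕ → Configuration n) (t : ℕ) : Finset (Fin n) :=
  Finset.univ.filter fun z => x t z ≠ x (t + 1) z

/-- The combinatorial properties of the first `N` steps of a run that the argument uses: one or two
nodes move at each step, no configuration occurs twice, and the run does not come back to a
configuration that arises from an earlier one by only a part of the move made there. -/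
structure IsReducedRun (x : ℕ → Configuration n) (N : ℕ) : Prop where
  nonempty : ∀ t < N, (movedSet x t).Nonempty
  card_le : ∀ t < N, (movedSet x t).card ≤ 2
  ne : ∀ s t, s < t → t ≤ N → x s ≠ x t
  ne_flip : ∀ s t, s + 1 < t → t ≤ N → ∀ a ∈ movedSet x s,
    x t ≠ Function.update (x s) a (x (s + 1) a)

lemma mem_movedSet {x : ℕ → Configuration n} {t : ℕ} {z : Fin n} :
    z ∈ movedSet x t ↔ x t z ≠ x (t + 1) z := by
  simp [movedSet]

lemma units_eq_of_ne_of_ne {a b c : ℤˣ} (h : a ≠ b) (h' : b ≠ c) : a = c := by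
  rcases Int.units_eq_one_or a with rfl | rfl <;> rcases Int.units_eq_one_or b with rfl | rfl <;>
    rcases Int.units_eq_one_or c with rfl | rfl <;> simp_all

lemma units_eq_neg_of_ne {a b : ℤˣ} (h : a ≠ b) : b = -a := by
  rcases Int.units_eq_one_or a with rfl | rfl <;> rcases Int.units_eq_one_or b with rfl | rfl <;>
    simp_all

/-- In a reduced run, the configurations at two moves of `u` from the same sign differ at a node
that takes part in neither move. -/
lemma IsReducedRun.exists_witness_of_lt {x : ℕ → Configuration n} {N : ℕ} (hx : IsReducedRun x N)
    {s t : ℕ} (hst : s < t) (ht : t < N) {u : Fin n} (hus : u ∈ movedSet x s)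
    (hut : u ∈ movedSet x t) (hu : x s u = x t u) :
    ∃ w, w ∉ movedSet x s ∧ w ∉ movedSet x t ∧ x s w ≠ x t w := by
  by_contra! hcon
  have hpair : ∀ r < N, u ∈ movedSet x r → ∀ a ∈ movedSet x r, a ≠ u → ∀ z ∈ movedSet x r,
      z = u ∨ z = a := by
    intro r hr hur a ha hau z hz
    by_contra! h
    have h3 : ({u, a, z} : Finset (Fin n)).card = 3 :=
      Finset.card_eq_three.2 ⟨u, a, z, hau.symm, h.1.symm, h.2.symm, rfl⟩
    have h4 : ({u, a, z} : Finset (Fin n)) ⊆ movedSet x r := by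
      intro y hy
      simp only [Finset.mem_insert, Finset.mem_singleton] at hy
      rcases hy with rfl | rfl | rfl <;> assumption
    have := Finset.card_le_card h4
    have := hx.card_le r hr
    omega
  have hs1 : s + 1 < t := by
    rcases (by omega : s + 1 = t ∨ s + 1 < t) with h | h
    · subst h
      exact absurd hu (mem_movedSet.1 hus)
    · exact h
  have hfix : ∀ r z, z ∉ movedSet x r → x r z = x (r + 1) z := fun r z hz => by
    by_contra h
    exact hz (mem_movedSet.2 h)
  by_cases hA : ∃ a, x s a ≠ x t a ∧ a ∈ movedSet x s
  · obtain ⟨a, haΔ, has⟩ := hA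
    have hau : a ≠ u := fun h => haΔ (h ▸ hu)
    have hMs := hpair s (by omega) hus a has hau
    by_cases hB : ∃ b, x s b ≠ x t b ∧ b ≠ a
    · obtain ⟨b, hbΔ, hba⟩ := hB
      have hbu : b ≠ u := fun h => hbΔ (h ▸ hu)
      have hbs : b ∉ movedSet x s := fun h => by
        rcases hMs b h with h | h
        · exact hbu h
        · exact hba h
      have hbt : b ∈ movedSet x t := by
        by_contra h
        exact hbΔ (hcon b hbs h)
      have hMt := hpair t ht hut b hbt hbu
      -- Both moves together lead from `x s` to `x (s + 1)` again.
      refine hx.ne (s + 1) (t + 1) (by omega) (by omega) (funext fun z => ?_)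
      by_cases hzu : z = u
      · subst hzu
        exact units_eq_of_ne_of_ne (mem_movedSet.1 hus).symm (hu ▸ mem_movedSet.1 hut)
      by_cases hza : z = a
      · subst hza
        have h1 : z ∉ movedSet x t := fun h => by
          rcases hMt z h with h | h
          · exact hzu h
          · exact hba h.symm
        rw [← hfix t z h1]
        exact units_eq_of_ne_of_ne (mem_movedSet.1 has).symm haΔ
      by_cases hzb : z = b
      · subst hzb
        rw [← hfix s z hbs]
        exact units_eq_of_ne_of_ne hbΔ (mem_movedSet.1 hbt)
      have h1 : z ∉ movedSet x s := fun h => (hMs z h).elim hzu hza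
      have h2 : z ∉ movedSet x t := fun h => (hMt z h).elim hzu hzb
      rw [← hfix s z h1, ← hfix t z h2]
      exact hcon z h1 h2
    · push Not at hB
      refine hx.ne_flip s t hs1 ht.le a has (funext fun z => ?_)
      by_cases hza : z = a
      · subst hza
        rw [Function.update_self]
        exact units_eq_of_ne_of_ne haΔ.symm (mem_movedSet.1 has)
      · rw [Function.update_of_ne hza]
        by_contra h
        exact hza (hB z (Ne.symm h))
  · push Not at hA
    by_cases hB : ∃ b, x s b ≠ x t b
    · obtain ⟨b, hbΔ⟩ := hB
      have hbu : b ≠ u := fun h => hbΔ (h ▸ hu)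
      have hbt : b ∈ movedSet x t := by
        by_contra h
        exact hbΔ (hcon b (hA b hbΔ) h)
      have hMt := hpair t ht hut b hbt hbu
      refine hx.ne_flip s (t + 1) (by omega) (by omega) u hus (funext fun z => ?_)
      by_cases hzu : z = u
      · subst hzu
        rw [Function.update_self]
        exact units_eq_of_ne_of_ne (hu ▸ mem_movedSet.1 hut).symm (mem_movedSet.1 hus)
      rw [Function.update_of_ne hzu]
      by_cases hzb : z = b
      · subst hzb
        exact units_eq_of_ne_of_ne (mem_movedSet.1 hbt).symm hbΔ.symm
      have h2 : z ∉ movedSet x t := fun h => (hMt z h).elim hzu hzb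
      rw [← hfix t z h2]
      by_contra h
      exact h (hcon z (hA z (Ne.symm h)) h2).symm
    · push Not at hB
      exact hx.ne s t hst ht.le (funext hB)

lemma IsReducedRun.exists_witness {x : ℕ → Configuration n} {N : ℕ} (hx : IsReducedRun x N)
    {s t : ℕ} (hst : s ≠ t) (hs : s < N) (ht : t < N) {u : Fin n} (hus : u ∈ movedSet x s)
    (hut : u ∈ movedSet x t) (hu : x s u = x t u) :
    ∃ w, w ∉ movedSet x s ∧ w ∉ movedSet x t ∧ x s w ≠ x t w := by
  rcases lt_or_gt_of_ne hst with h | h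
  · exact hx.exists_witness_of_lt h ht hus hut hu
  · obtain ⟨w, h1, h2, h3⟩ := hx.exists_witness_of_lt h hs hut hus hu.symm
    exact ⟨w, h2, h1, h3.symm⟩

/-- Twice the coefficient of the weight of the edge `{z, w}` in the combination with coefficients
`b` of the gains of the moves of `x` at the times in `T`. -/
def gainCoeff (x : ℕ → Configuration n) (T : Finset ℕ) (b : ℕ → ℤ) (z w : Fin n) : ℤ :=
  ∑ t ∈ T, b t * ((x t z : ℤ) * (x t w : ℤ) - (x (t + 1) z : ℤ) * (x (t + 1) w : ℤ))

/-- A certificate for the moves of `x` at the times in `T`: combinations of gains with small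
integer coefficients, in which the nodes that do not move cancel out (`kernel`), and edges
`{u i, w i}`, each of which occurs in the `i`-th combination only. -/
structure IsCertificate (x : ℕ → Configuration n) (T : Finset ℕ) (A : ℕ) {r : ℕ}
    (b : Fin r → ℕ → ℤ) (u w : Fin r → Fin n) : Prop where
  sum_abs_le : ∀ i, ∑ t ∈ T, |b i t| ≤ A
  kernel : ∀ i z, ∑ t ∈ T, b i t * ((x t z : ℤ) - (x (t + 1) z : ℤ)) = 0
  ne : ∀ i, u i ≠ w i
  diag : ∀ i, gainCoeff x T (b i) (u i) (w i) ≠ 0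
  offDiag : ∀ i j, i ≠ j → gainCoeff x T (b j) (u i) (w i) = 0

lemma exists_majority_sign {ι α : Type*} [DecidableEq α] (T : Finset ι) (f : ι → α) (s : ι → ℤˣ) :
    ∃ σ : α → ℤˣ, T.card ≤ 2 * (T.filter fun t => s t = σ (f t)).card := by
  have h : ∀ a, ∃ σ : ℤˣ, (T.filter fun t => f t = a).card ≤
      2 * (T.filter fun t => f t = a ∧ s t = σ).card := by
    intro a
    have h1 := Finset.card_filter_add_card_filter_not (s := T.filter fun t => f t = a)
      (fun t => s t = 1)
    rw [Finset.filter_filter, Finset.filter_filter] at h1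
    have h2 : (T.filter fun t => f t = a ∧ ¬ s t = 1) = T.filter fun t => f t = a ∧ s t = -1 := by
      refine Finset.filter_congr fun t _ => and_congr_right fun _ => ?_
      rcases Int.units_eq_one_or (s t) with h | h <;> simp [h]
    rw [h2] at h1
    rcases le_total (T.filter fun t => f t = a ∧ s t = 1).card
      (T.filter fun t => f t = a ∧ s t = -1).card with h | h
    · exact ⟨-1, by omega⟩
    · exact ⟨1, by omega⟩
  choose σ hσ using h
  refine ⟨σ, ?_⟩
  have h1 := Finset.card_eq_sum_card_image f T
  have h2 := Finset.card_eq_sum_card_fiberwise (s := T.filter fun t => s t = σ (f t))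
    (f := f) (t := T.image f) (fun t ht => Finset.mem_coe.2 (Finset.mem_image_of_mem f
      (Finset.mem_filter.1 (Finset.mem_coe.1 ht)).1))
  rw [h1, h2, Finset.mul_sum]
  refine Finset.sum_le_sum fun a _ => (hσ a).trans (le_of_eq ?_)
  rw [Finset.filter_filter]
  congr 2
  ext t
  simp only [Finset.mem_filter]
  constructor
  · rintro ⟨h, rfl, h'⟩; exact ⟨h, h', rfl⟩
  · rintro ⟨h, h', rfl⟩; exact ⟨h, rfl, h'⟩

end Certificates

/-! ### Certificates from cycles of movers and partners -/

section CertificateExistence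

variable {n : ℕ}

lemma edgeBoundary_inl (T : Finset ℕ) (u : ℕ → Fin n) (v : ℕ → Option (Fin n)) (b : ℕ → ℤ)
    (z : Fin n) :
    edgeBoundary T (fun t => (Sum.inl (u t) : Fin n ⊕ Option (Fin n))) (fun t => Sum.inr (v t)) b
      (Sum.inl z) = ∑ t ∈ T, if u t = z then b t else 0 := by
  simp [edgeBoundary]

lemma edgeBoundary_inr (T : Finset ℕ) (u : ℕ → Fin n) (v : ℕ → Option (Fin n)) (b : ℕ → ℤ)
    (z : Option (Fin n)) :
    edgeBoundary T (fun t => (Sum.inl (u t) : Fin n ⊕ Option (Fin n))) (fun t => Sum.inr (v t)) b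
      (Sum.inr z) = - ∑ t ∈ T, if v t = z then b t else 0 := by
  simp [edgeBoundary, ← Finset.sum_neg_distrib, apply_ite Neg.neg]

/-- Cycles in the bipartite multigraph of movers and partners yield a certificate, if the movers
have colour `2`, their partners have colour `3`, every node moves from one sign only, and two
moves of the same mover are told apart by a node of colour `0` or `1`. -/
lemma exists_isCertificate_of_cycles (x : ℕ → Configuration n) (W T : Finset ℕ) (hTW : T ⊆ W)
    (u : ℕ → Fin n) (v : ℕ → Option (Fin n))
    (hmove : ∀ t ∈ T, ∀ z, z ∈ movedSet x t ↔ z = u t ∨ v t = some z)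
    (σ τ : Fin n → ℤˣ) (hσ : ∀ t ∈ T, x t (u t) = σ (u t))
    (hτ : ∀ t ∈ T, ∀ z, v t = some z → x t z = τ z)
    (c : Fin n → Fin 4) (hcu : ∀ t ∈ T, c (u t) = 2) (hcv : ∀ t ∈ T, ∀ z, v t = some z → c z = 3)
    (hsep : ∀ s ∈ T, ∀ t ∈ T, s ≠ t → u s = u t → ∃ w, c w < 2 ∧ x s w ≠ x t w)
    (A : ℕ) {r : ℕ} (b : Fin r → ℕ → ℤ) (hb : ∀ i t, b i t ≠ 0 → t ∈ T)
    (hb0 : ∀ i, ∃ t, b i t ≠ 0) (hA : ∀ i, ∑ t ∈ T, |b i t| ≤ A)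
    (hbd : ∀ i z, edgeBoundary T (fun t => (Sum.inl (u t) : Fin n ⊕ Option (Fin n)))
      (fun t => Sum.inr (v t)) (b i) z = 0)
    (h3 : ∀ i z, (T.filter fun t => b i t ≠ 0 ∧ u t = z).card ≤ 3)
    (hdisj : ∀ i j t t', i ≠ j → b i t ≠ 0 → b j t' ≠ 0 → u t ≠ u t') :
    ∃ u' w', IsCertificate x W A b u' w' := by
  have hWT : ∀ i, ∀ f : ℕ → ℤ, ∑ t ∈ W, b i t * f t = ∑ t ∈ T, b i t * f t := by
    intro i f
    refine (Finset.sum_subset hTW fun t _ ht => ?_).symm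
    have : b i t = 0 := by
      by_contra h
      exact ht (hb i t h)
    rw [this, zero_mul]
  have hfix : ∀ t ∈ T, ∀ z, z ≠ u t → v t ≠ some z → x (t + 1) z = x t z := by
    intro t ht z h1 h2
    by_contra h
    rcases (hmove t ht z).1 (mem_movedSet.2 (Ne.symm h)) with h' | h'
    · exact h1 h'
    · exact h2 h'
  have hflip : ∀ t ∈ T, ∀ z, z = u t ∨ v t = some z → x (t + 1) z = - x t z := fun t ht z h =>
    units_eq_neg_of_ne (mem_movedSet.1 ((hmove t ht z).2 h))
  have hfixB : ∀ t ∈ T, ∀ w, c w < 2 → x (t + 1) w = x t w := by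
    intro t ht w hw
    refine hfix t ht w ?_ ?_
    · rintro rfl
      rw [hcu t ht] at hw
      exact absurd hw (by decide)
    · intro h
      rw [hcv t ht w h] at hw
      exact absurd hw (by decide)
  -- A node `z` of colour `2` moves at the times `t` of `T` with `u t = z`, always from `σ z`.
  have hdiff : ∀ t ∈ T, ∀ z, c z = 2 → ((x t z : ℤ) - (x (t + 1) z : ℤ)) =
      if u t = z then 2 * (σ z : ℤ) else 0 := by
    intro t ht z hz
    split_ifs with h
    · subst h
      rw [hflip t ht (u t) (Or.inl rfl), hσ t ht, Units.val_neg]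
      ring
    · rw [hfix t ht z (Ne.symm h) fun h' => by
        rw [hcv t ht z h'] at hz
        exact absurd hz (by decide), sub_self]
  have hsumu : ∀ i z, (∑ t ∈ T, if u t = z then b i t else 0) = 0 := fun i z => by
    rw [← edgeBoundary_inl T u v]
    exact hbd i _
  have hsumv : ∀ i z, (∑ t ∈ T, if v t = z then b i t else 0) = 0 := fun i z => by
    have := hbd i (Sum.inr z)
    rw [edgeBoundary_inr T u v] at this
    exact neg_eq_zero.1 this
  have hgain : ∀ i z w, c z = 2 → c w < 2 → gainCoeff x W (b i) z w =
      2 * (σ z : ℤ) * ∑ t ∈ T.filter (fun t => b i t ≠ 0 ∧ u t = z), b i t * (x t w : ℤ) := by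
    intro i z w hz hw
    rw [gainCoeff, hWT i, Finset.mul_sum, Finset.sum_filter]
    refine Finset.sum_congr rfl fun t ht => ?_
    rw [hfixB t ht w hw, ← sub_mul, hdiff t ht z hz]
    by_cases h1 : u t = z <;> by_cases h2 : b i t = 0 <;> simp [h1, h2]
    ring
  have hcols : ∀ i, ∃ z w, c z = 2 ∧ c w < 2 ∧ (∃ t, b i t ≠ 0 ∧ u t = z) ∧
      gainCoeff x W (b i) z w ≠ 0 := by
    intro i
    obtain ⟨t₀, ht₀⟩ := hb0 i
    have ht₀T := hb i t₀ ht₀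
    set F := T.filter fun t => b i t ≠ 0 ∧ u t = u t₀ with hF
    have hFT : ∀ t ∈ F, t ∈ T ∧ b i t ≠ 0 ∧ u t = u t₀ := fun t ht => Finset.mem_filter.1 ht
    have hFsum : ∑ t ∈ F, b i t = 0 := by
      rw [← hsumu i (u t₀), hF, Finset.sum_filter]
      refine Finset.sum_congr rfl fun t _ => ?_
      by_cases h1 : u t = u t₀ <;> by_cases h2 : b i t = 0 <;> simp [h1, h2]
    obtain ⟨s, hs, t, ht, w, hw, hne⟩ := exists_coordinate_sum_ne_zero F (b i)
      (fun t => testTrace c (x t)) (fun t ht => (hFT t ht).2.1)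
      ⟨t₀, Finset.mem_filter.2 ⟨ht₀T, ht₀, rfl⟩⟩ (h3 i (u t₀)) hFsum (by
        intro s hs t ht hst
        obtain ⟨w, hw, hxw⟩ := hsep s (hFT s hs).1 t (hFT t ht).1 hst
          ((hFT s hs).2.2.trans (hFT t ht).2.2.symm)
        exact ⟨w, by simpa [testTrace, hw] using hxw⟩)
    have hcw : c w < 2 := by
      by_contra h
      simp [testTrace, h] at hw
    simp only [testTrace, hcw, if_true] at hne
    refine ⟨u t₀, w, hcu t₀ ht₀T, hcw, ⟨t₀, ht₀, rfl⟩, ?_⟩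
    rw [hgain i (u t₀) w (hcu t₀ ht₀T) hcw]
    refine mul_ne_zero (mul_ne_zero two_ne_zero (Units.ne_zero _)) hne
  choose u' w' hcu' hcw' hu' hdiag using hcols
  refine ⟨u', w', ⟨?_, ?_, ?_, hdiag, ?_⟩⟩
  · intro i
    rw [← Finset.sum_subset hTW fun t _ ht => ?_]
    · exact hA i
    · have : b i t = 0 := by
        by_contra h
        exact ht (hb i t h)
      simp [this]
  · intro i z
    rw [hWT i]
    by_cases hz2 : c z = 2
    · rw [Finset.sum_congr rfl fun t ht => by rw [hdiff t ht z hz2]]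
      have := congrArg (fun a => a * (2 * (σ z : ℤ))) (hsumu i z)
      simp only [zero_mul, Finset.sum_mul] at this
      refine Eq.trans (Finset.sum_congr rfl fun t _ => ?_) this
      by_cases h : u t = z <;> simp [h]
    · have hd : ∀ t ∈ T, b i t * ((x t z : ℤ) - (x (t + 1) z : ℤ)) =
          (if v t = some z then b i t else 0) * (2 * (τ z : ℤ)) := by
        intro t ht
        have hne : z ≠ u t := fun h => hz2 (h ▸ hcu t ht)
        split_ifs with h
        · rw [hflip t ht z (Or.inr h), hτ t ht z h, Units.val_neg]
          ring
        · rw [hfix t ht z hne h, sub_self, mul_zero, zero_mul]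
      rw [Finset.sum_congr rfl hd, ← Finset.sum_mul, hsumv i (some z), zero_mul]
  · intro i h
    have h1 := hcw' i
    rw [← h, hcu' i] at h1
    exact absurd h1 (by decide)
  · intro i j hij
    obtain ⟨t₀, ht₀, hut₀⟩ := hu' i
    rw [hgain j (u' i) (w' i) (hcu' i) (hcw' i), Finset.filter_eq_empty_iff.2, Finset.sum_empty,
      mul_zero]
    rintro t _ ⟨h1, h2⟩
    exact hdisj i j t₀ t hij ht₀ h1 (hut₀.trans h2.symm)

/-- A long reduced run has a dyadic window whose moves have a certificate with a number of rows
that is the length of the window up to a polylogarithmic factor. -/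
theorem exists_isCertificate (x : ℕ → Configuration n) (κ : ℕ) (hκ : 0 < κ)
    (hx : IsReducedRun x (2 ^ κ)) (hn : 2 ^ 34 * n * κ ^ 4 ≤ 2 ^ κ) :
    ∃ k < κ, ∃ j < 2 ^ (κ - k), ∃ r : ℕ, 2 ^ k ≤ r * (2 ^ 59 * κ ^ 8) ∧
      ∃ (b : Fin r → ℕ → ℤ) (u w : Fin r → Fin n),
        IsCertificate x ((Finset.range (2 ^ κ)).filter fun t => t / 2 ^ k = j) (4 * κ + 1) b u w := by
  set d := 2 ^ 28 * κ ^ 3 with hd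
  set D := 2 ^ 32 * κ ^ 4 with hD
  obtain ⟨k, hk, j, hj, hcard⟩ := exists_good_window (movedSet x) κ d D hκ (by positivity)
    hx.card_le hx.nonempty (le_of_eq (by rw [hd, hD]; ring)) (by
      rw [Fintype.card_fin, hD]
      exact le_trans (le_of_eq (by ring)) hn)
  refine ⟨k, hk, j, hj, ?_⟩
  set W := (Finset.range (2 ^ κ)).filter fun t => t / 2 ^ k = j with hW
  set deg := windowDegree (movedSet x) (2 ^ κ) k j with hdeg
  have hdegW : ∀ z, deg z = (W.filter fun t => z ∈ movedSet x t).card := fun z => by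
    rw [hdeg, windowDegree, hW, Finset.filter_filter]
  set T₀ := (Finset.range (2 ^ κ)).filter fun t =>
      t / 2 ^ k = j ∧ (∀ z ∈ movedSet x t, d ≤ deg z) ∧
        ∃ z ∈ movedSet x t, deg z < D with hT₀
  replace hcard : 2 ^ k ≤ 2 * κ * T₀.card := by convert hcard
  have hT₀W : T₀ ⊆ W := fun t ht => by
    simp only [hT₀, hW, Finset.mem_filter] at ht ⊢
    exact ⟨ht.1, ht.2.1⟩
  have hWN : ∀ t ∈ W, t < 2 ^ κ := fun t ht => Finset.mem_range.1 (Finset.mem_filter.1 ht).1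
  have hWcard : W.card ≤ 2 ^ k := by
    have : W ⊆ Finset.Ico (j * 2 ^ k) (j * 2 ^ k + 2 ^ k) := by
      intro t ht
      have h1 := (Finset.mem_filter.1 ht).2
      have h2 := Nat.div_add_mod t (2 ^ k)
      have h3 := Nat.mod_lt t (Nat.two_pow_pos k)
      rw [h1, mul_comm] at h2
      rw [Finset.mem_Ico]
      omega
    simpa using Finset.card_le_card this
  have hdesig : ∀ t, ∃ (u : Option (Fin n)) (v : Option (Fin n)), t ∈ T₀ → ∃ u₀, u = some u₀ ∧
      deg u₀ < D ∧ v ≠ some u₀ ∧ ∀ z, z ∈ movedSet x t ↔ z = u₀ ∨ v = some z := by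
    intro t
    by_cases ht : t ∈ T₀
    · obtain ⟨htN, _, _, z, hz, hzD⟩ := Finset.mem_filter.1 ht
      by_cases ha : ∃ a ∈ movedSet x t, a ≠ z
      · obtain ⟨a, ha, haz⟩ := ha
        refine ⟨some z, some a, fun _ => ⟨z, rfl, hzD, fun h => haz (Option.some.inj h), ?_⟩⟩
        have h2 : ({z, a} : Finset (Fin n)) = movedSet x t := by
          refine Finset.eq_of_subset_of_card_le ?_ ?_
          · intro y hy
            simp only [Finset.mem_insert, Finset.mem_singleton] at hy
            rcases hy with rfl | rfl <;> assumption
          · rw [Finset.card_pair haz.symm]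
            exact hx.card_le t (Finset.mem_range.1 htN)
        intro y
        rw [← h2]
        simp [eq_comm]
      · push Not at ha
        refine ⟨some z, none, fun _ => ⟨z, rfl, hzD, by simp, fun y => ?_⟩⟩
        simp only [reduceCtorEq, or_false]
        exact ⟨ha y, fun h => h ▸ hz⟩
    · exact ⟨none, none, fun h => absurd h ht⟩
  choose u' v hdesig using hdesig
  have hT₀pos : 0 < T₀.card := by
    rcases Nat.eq_zero_or_pos T₀.card with h | h
    · rw [h] at hcard
      have := Nat.two_pow_pos k
      omega
    · exact h
  obtain ⟨t₀, ht₀⟩ := Finset.card_pos.1 hT₀pos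
  obtain ⟨z₀, -⟩ := hdesig t₀ ht₀
  set u : ℕ → Fin n := fun t => (u' t).getD z₀ with hu
  have hdes : ∀ t ∈ T₀, deg (u t) < D ∧ v t ≠ some (u t) ∧
      ∀ z, z ∈ movedSet x t ↔ z = u t ∨ v t = some z := by
    intro t ht
    obtain ⟨u₀, h1, h2⟩ := hdesig t ht
    have : u t = u₀ := by simp [hu, h1]
    rw [this]
    exact h2
  have hheavy : ∀ t ∈ T₀, ∀ z ∈ movedSet x t, d ≤ deg z := fun t ht =>
    (Finset.mem_filter.1 ht).2.2.1
  -- Keep the moves in which each node moves from its majority sign.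
  obtain ⟨σ, hσ⟩ := exists_majority_sign T₀ u fun t => x t (u t)
  set T₁ := T₀.filter fun t => x t (u t) = σ (u t) with hT₁
  obtain ⟨τ, hτ⟩ := exists_majority_sign T₁ v fun t => (v t).elim 1 (x t)
  set T₂ := T₁.filter fun t => (v t).elim 1 (x t) = τ (v t) with hT₂
  have hT₁₀ : T₁ ⊆ T₀ := Finset.filter_subset _ _
  have hT₂₀ : T₂ ⊆ T₀ := (Finset.filter_subset _ _).trans hT₁₀
  have hσ₂ : ∀ t ∈ T₂, x t (u t) = σ (u t) := fun t ht =>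
    (Finset.mem_filter.1 (Finset.mem_filter.1 ht).1).2
  have hlight : ∀ z, (T₂.filter fun t => u t = z).card ≤ D := by
    intro z
    rcases (T₂.filter fun t => u t = z).eq_empty_or_nonempty with h | ⟨s, hs⟩
    · simp [h]
    · obtain ⟨hs2, rfl⟩ := Finset.mem_filter.1 hs
      refine le_trans (Finset.card_le_card ?_) (hdes s (hT₂₀ hs2)).1.le
      intro t ht
      obtain ⟨ht2, hut⟩ := Finset.mem_filter.1 ht
      have h1 := Finset.mem_filter.1 (hT₂₀ ht2)
      exact Finset.mem_filter.2 ⟨h1.1, h1.2.1,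
        ((hdes t (hT₂₀ ht2)).2.2 _).2 (Or.inl hut.symm)⟩
  obtain ⟨c, T, hT, hc, hsep, hTcard⟩ := exists_colouring T₂ u v x D hlight
    (fun t ht => (hdes t (hT₂₀ ht)).2.1) σ hσ₂ (by
      intro s hs t ht hst hust
      have hs0 := hdes s (hT₂₀ hs)
      have ht0 := hdes t (hT₂₀ ht)
      obtain ⟨w, h1, h2, h3⟩ := hx.exists_witness hst (hWN s (hT₀W (hT₂₀ hs)))
        (hWN t (hT₀W (hT₂₀ ht))) (u := u s) ((hs0.2.2 _).2 (Or.inl rfl))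
        ((ht0.2.2 _).2 (Or.inl hust)) (by rw [hσ₂ s hs, hust, hσ₂ t ht])
      exact ⟨w, fun h => h1 ((hs0.2.2 w).2 (Or.inr h)), fun h => h2 ((ht0.2.2 w).2 (Or.inr h)),
        h3⟩)
  have hT0 : T ⊆ T₀ := hT.trans hT₂₀
  have hTlarge : 2 ^ k ≤ 2 ^ 23 * κ ^ 3 * T.card := by
    have hsq : √(D : ℝ) = 2 ^ 16 * (κ : ℝ) ^ 2 := by
      rw [hD, Nat.cast_mul, Nat.cast_pow, Nat.cast_pow, Nat.cast_ofNat,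
        show (2 : ℝ) ^ 32 * (κ : ℝ) ^ 4 = (2 ^ 16 * (κ : ℝ) ^ 2) ^ 2 by ring]
      exact Real.sqrt_sq (by positivity)
    rw [hsq] at hTcard
    have h1 : T₂.card ≤ 16 * (2 ^ 16 * κ ^ 2) * T.card := by exact_mod_cast hTcard
    calc 2 ^ k ≤ 2 * κ * T₀.card := hcard
      _ ≤ 2 * κ * (2 * (2 * (16 * (2 ^ 16 * κ ^ 2) * T.card))) := by
        gcongr
        exact hσ.trans (Nat.mul_le_mul_left _ (hτ.trans (Nat.mul_le_mul_left _ h1)))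
      _ = 2 ^ 23 * κ ^ 3 * T.card := by ring
  have hTpos : 0 < T.card := by
    rcases Nat.eq_zero_or_pos T.card with h | h
    · rw [h, mul_zero] at hTlarge
      have := Nat.two_pow_pos k
      omega
    · exact h
  -- The multigraph of movers and partners has few vertices, since these are heavy nodes.
  set fst : ℕ → Fin n ⊕ Option (Fin n) := fun t => Sum.inl (u t) with hfst
  set snd : ℕ → Fin n ⊕ Option (Fin n) := fun t => Sum.inr (v t) with hsnd
  set S := T.image fst ∪ T.image snd with hS
  set H := Finset.univ.filter fun z => d ≤ deg z with hH
  have hHcard : d * H.card ≤ 2 * 2 ^ k := by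
    calc d * H.card = H.card • d := by rw [smul_eq_mul, mul_comm]
      _ ≤ ∑ z ∈ H, deg z := Finset.card_nsmul_le_sum _ _ _ fun z hz => (Finset.mem_filter.1 hz).2
      _ ≤ ∑ z, deg z := Finset.sum_le_sum_of_subset (Finset.subset_univ _)
      _ = ∑ z, (W.filter fun t => z ∈ movedSet x t).card := Finset.sum_congr rfl fun z _ => hdegW z
      _ ≤ 2 * W.card := sum_card_filter_mem_le _ _ fun t ht => hx.card_le t (hWN t ht)
      _ ≤ 2 * 2 ^ k := Nat.mul_le_mul_left _ hWcard
  have hdk : d ≤ 2 ^ k := by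
    have h1 := hheavy t₀ ht₀ (u t₀) (((hdes t₀ ht₀).2.2 _).2 (Or.inl rfl))
    rw [hdegW] at h1
    exact h1.trans ((Finset.card_filter_le _ _).trans hWcard)
  have hScard : d * S.card ≤ 5 * 2 ^ k := by
    have h1 : (T.image fst).card ≤ H.card := by
      refine le_trans (Finset.card_le_card ?_) (Finset.card_image_le (f := Sum.inl) (s := H))
      intro y hy
      obtain ⟨t, ht, rfl⟩ := Finset.mem_image.1 hy
      refine Finset.mem_image_of_mem _ (Finset.mem_filter.2 ⟨Finset.mem_univ _, ?_⟩)
      exact hheavy t (hT0 ht) _ (((hdes t (hT0 ht)).2.2 _).2 (Or.inl rfl))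
    have h2 : (T.image snd).card ≤ H.card + 1 := by
      have h3 : T.image snd ⊆ (insert none (H.image some)).image Sum.inr := by
        intro y hy
        obtain ⟨t, ht, rfl⟩ := Finset.mem_image.1 hy
        refine Finset.mem_image_of_mem _ ?_
        rcases hv : v t with _ | z
        · exact Finset.mem_insert_self _ _
        · refine Finset.mem_insert_of_mem (Finset.mem_image_of_mem _
            (Finset.mem_filter.2 ⟨Finset.mem_univ _, ?_⟩))
          exact hheavy t (hT0 ht) _ (((hdes t (hT0 ht)).2.2 _).2 (Or.inr hv))
      refine (Finset.card_le_card h3).trans (Finset.card_image_le.trans ?_)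
      exact (Finset.card_insert_le _ _).trans (Nat.succ_le_succ Finset.card_image_le)
    have h3 : S.card ≤ 2 * H.card + 1 := by
      have h4 : S.card ≤ (T.image fst).card + (T.image snd).card := Finset.card_union_le _ _
      omega
    calc d * S.card ≤ d * (2 * H.card + 1) := by gcongr
      _ = 2 * (d * H.card) + d := by ring
      _ ≤ 5 * 2 ^ k := by omega
  have hST : 4 * S.card ≤ T.card := by
    have h1 : (2 ^ 23 * κ ^ 3) * (32 * S.card) ≤ (2 ^ 23 * κ ^ 3) * (5 * T.card) := by
      calc (2 ^ 23 * κ ^ 3) * (32 * S.card) = d * S.card := by rw [hd]; ring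
        _ ≤ 5 * 2 ^ k := hScard
        _ ≤ 5 * (2 ^ 23 * κ ^ 3 * T.card) := by gcongr
        _ = _ := by ring
    have := Nat.le_of_mul_le_mul_left h1 (by positivity)
    omega
  have hSne : S.Nonempty := by
    obtain ⟨t, ht⟩ := Finset.card_pos.1 hTpos
    exact ⟨fst t, Finset.mem_union_left _ (Finset.mem_image_of_mem _ ht)⟩
  have hSR : S.card * 2 ^ (2 * κ) < 3 ^ (2 * κ) := by
    have h1 : S.card ≤ 2 ^ κ := by
      have h2 : S.card ≤ 2 * n + 1 := by
        refine (Finset.card_le_univ _).trans (le_of_eq ?_)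
        simp
        ring
      have h3 : n ≤ n * κ ^ 4 := Nat.le_mul_of_pos_right _ (by positivity)
      have h4 : 0 < n := Fin.pos z₀
      calc S.card ≤ 2 * n + 1 := h2
        _ ≤ 2 ^ 34 * (n * κ ^ 4) := by omega
        _ = 2 ^ 34 * n * κ ^ 4 := by ring
        _ ≤ 2 ^ κ := hn
    calc S.card * 2 ^ (2 * κ) ≤ 2 ^ κ * 2 ^ (2 * κ) := by gcongr
      _ = 8 ^ κ := by rw [← pow_add, show (8 : ℕ) = 2 ^ 3 by norm_num, ← pow_mul]; congr 1; ring
      _ < 9 ^ κ := Nat.pow_lt_pow_left (by norm_num) hκ.ne'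
      _ = 3 ^ (2 * κ) := by rw [pow_mul]; norm_num
  set M := (2 * (2 * κ) + 1) * D with hM
  have hMpos : 0 < M := by positivity
  set r := T.card / (2 * M) + 1 with hr
  have hr1 : (r - 1) * M + 2 * S.card ≤ T.card := by
    have h1 := Nat.div_mul_le_self T.card (2 * M)
    have h2 : (r - 1) * M * 2 = T.card / (2 * M) * (2 * M) := by rw [hr, Nat.add_sub_cancel]; ring
    omega
  refine ⟨r, ?_, ?_⟩
  · have h1 : T.card ≤ r * (2 * M) := by
      have h2 := Nat.lt_div_mul_add (a := T.card) (b := 2 * M) (by positivity)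
      rw [hr, Nat.add_mul, one_mul]
      exact h2.le
    have h2 : M ≤ 5 * 2 ^ 32 * κ ^ 5 := by
      calc M ≤ (5 * κ) * D := Nat.mul_le_mul_right _ (by omega)
        _ = _ := by rw [hD]; ring
    calc 2 ^ k ≤ 2 ^ 23 * κ ^ 3 * T.card := hTlarge
      _ ≤ 2 ^ 23 * κ ^ 3 * (r * (2 * (5 * 2 ^ 32 * κ ^ 5))) := by
        gcongr
        exact h1.trans (by gcongr)
      _ = r * (10 * 2 ^ 55 * κ ^ 8) := by ring
      _ ≤ r * (2 ^ 59 * κ ^ 8) := by gcongr; norm_num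
  · obtain ⟨b, b1, b2, b3, b4, b5, b6⟩ := exists_short_cycles fst snd S hSne (2 * κ) D hSR r T
      (fun t _ => by simp [hfst, hsnd])
      (fun t ht => ⟨Finset.mem_union_left _ (Finset.mem_image_of_mem _ ht),
        Finset.mem_union_right _ (Finset.mem_image_of_mem _ ht)⟩)
      (by
        intro z
        rcases z with z | z
        · refine le_trans (Finset.card_le_card fun t ht => ?_) (hlight z)
          obtain ⟨h1, h2⟩ := Finset.mem_filter.1 ht
          exact Finset.mem_filter.2 ⟨hT h1, Sum.inl_injective h2⟩
        · rw [Finset.filter_eq_empty_iff.2 fun t _ h => by simp [hfst] at h]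
          simp)
      hr1
    obtain ⟨u'', w'', h⟩ := exists_isCertificate_of_cycles x W T (hT0.trans hT₀W) u v
      (fun t ht => (hdes t (hT0 ht)).2.2) σ (fun z => τ (some z))
      (fun t ht => hσ₂ t (hT ht))
      (fun t ht z hz => by
        have := (Finset.mem_filter.1 (hT ht)).2
        simpa [hz] using this)
      c (fun t ht => (hc t ht).1) (fun t ht => (hc t ht).2) hsep (4 * κ + 1) b b1 b2
      (fun i => (b3 i).trans (le_of_eq (by push_cast; ring))) b4
      (fun i z => le_trans (Finset.card_le_card fun t ht => by
        obtain ⟨h1, h2, h3⟩ := Finset.mem_filter.1 ht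
        exact Finset.mem_filter.2 ⟨h1, h2, Or.inl (by rw [hfst]; simp [h3])⟩) (b5 i (Sum.inl z)))
      (fun i j t t' hij h1 h2 h3 => b6 i j t t' hij h1 h2 (by simp [hfst, h3]))
    exact ⟨b, u'', w'', h⟩

end CertificateExistence

/-! ### Anticoncentration of integer combinations of the weights -/

section Anticoncentration

lemma IsSmoothedWeightLaw.apply_le {φ : ℝ} {μ : Measure ℝ} (h : IsSmoothedWeightLaw φ μ)
    (s : Set ℝ) : μ s ≤ ENNReal.ofReal φ * volume s := by
  obtain ⟨f, _, hf, rfl⟩ := h.density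
  calc volume.withDensity f s ≤ volume.withDensity (fun _ => ENNReal.ofReal φ) s :=
        withDensity_mono (ae_of_all _ hf) s
    _ = ENNReal.ofReal φ * volume s := by simp [withDensity_const]

lemma IsSmoothedWeightLaw.apply_slab_le {φ : ℝ} (hφ : 0 ≤ φ) {μ : Measure ℝ}
    (h : IsSmoothedWeightLaw φ μ) {a : ℤ} (ha : a ≠ 0) (c η : ℝ) :
    μ {y | |(a : ℝ) * y + c| ≤ η} ≤ ENNReal.ofReal (2 * φ * η) := by
  have ha1 : (1 : ℝ) ≤ |(a : ℝ)| := by exact_mod_cast Int.one_le_abs ha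
  have ha0 : (a : ℝ) ≠ 0 := by exact_mod_cast ha
  have hsub : {y | |(a : ℝ) * y + c| ≤ η} ⊆ Set.Icc (-(c / a) - η) (-(c / a) + η) := by
    intro y hy
    have hy : |(a : ℝ) * y + c| ≤ η := hy
    have h1 : |y + c / a| ≤ η := by
      have h2 : (a : ℝ) * y + c = a * (y + c / a) := by field_simp
      rw [h2, abs_mul] at hy
      nlinarith [abs_nonneg (y + c / a)]
    have := abs_le.1 h1
    constructor <;> linarith [this.1, this.2]
  calc μ {y | |(a : ℝ) * y + c| ≤ η} ≤ ENNReal.ofReal φ * volume {y | |(a : ℝ) * y + c| ≤ η} :=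
        h.apply_le _
    _ ≤ ENNReal.ofReal φ * volume (Set.Icc (-(c / a) - η) (-(c / a) + η)) := by gcongr
    _ = ENNReal.ofReal (2 * φ * η) := by
        rw [Real.volume_Icc, ← ENNReal.ofReal_mul hφ]
        congr 1
        ring

/-- If each of `r` integer linear forms has a variable that occurs in no other form, then the
probability that all of them are small is at most the `r`-th power of the bound for one form. -/
lemma measure_forms_le {ι : Type*} [Fintype ι] [DecidableEq ι] {φ : ℝ} (hφ : 0 ≤ φ)
    (𝒳 : ι → Measure ℝ) (h𝒳 : ∀ e, IsSmoothedWeightLaw φ (𝒳 e)) {r : ℕ} (Z : Fin r → ι → ℤ)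
    (c : Fin r → ι) (hdiag : ∀ i, Z i (c i) ≠ 0) (hoff : ∀ i j, i ≠ j → Z j (c i) = 0) (η : ℝ) :
    Measure.pi 𝒳 {X : ι → ℝ | ∀ i, |∑ e, (Z i e : ℝ) * X e| ≤ η} ≤
      ENNReal.ofReal (2 * φ * η) ^ r := by
  classical
  have : ∀ e, IsProbabilityMeasure (𝒳 e) := fun e => (h𝒳 e).isProbabilityMeasure
  have hc : Function.Injective c := fun i j hij => by
    by_contra h
    exact hdiag j (hij ▸ hoff i j h)
  let p : ι → Prop := fun e => ∃ i, c i = e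
  have mp := measurePreserving_piEquivPiSubtypeProd (α := fun _ : ι => ℝ) 𝒳 p
  set S : Set (({e // p e} → ℝ) × ({e // ¬ p e} → ℝ)) := {q | ∀ i,
    |∑ e : {e // p e}, (Z i e : ℝ) * q.1 e + ∑ e : {e // ¬ p e}, (Z i e : ℝ) * q.2 e| ≤ η}
    with hS
  have hSm : MeasurableSet S := by
    rw [hS]
    simp only [Set.ofPred_forall]
    refine MeasurableSet.iInter fun i => measurableSet_le ?_ measurable_const
    fun_prop
  have hpre : {X : ι → ℝ | ∀ i, |∑ e, (Z i e : ℝ) * X e| ≤ η} =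
      (MeasurableEquiv.piEquivPiSubtypeProd (fun _ : ι => ℝ) p) ⁻¹' S := by
    ext X
    simp only [hS, Set.mem_ofPred_eq, Set.mem_preimage]
    refine forall_congr' fun i => ?_
    rw [← Fintype.sum_subtype_add_sum_subtype p]
    rfl
  rw [hpre, mp.measure_preimage hSm.nullMeasurableSet, Measure.prod_apply_symm hSm]
  have hslice : ∀ y : {e // ¬ p e} → ℝ,
      Measure.pi (fun e : {e // p e} => 𝒳 e) ((fun x => (x, y)) ⁻¹' S) ≤
        ENNReal.ofReal (2 * φ * η) ^ r := by
    intro y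
    set idx : {e // p e} → Fin r := fun e => e.2.choose with hidx
    have hidxc : ∀ e : {e // p e}, c (idx e) = e := fun e => e.2.choose_spec
    have hsub : (fun x => (x, y)) ⁻¹' S ⊆ Set.pi Set.univ fun e : {e // p e} =>
        {v : ℝ | |(Z (idx e) e : ℝ) * v + ∑ e' : {e // ¬ p e}, (Z (idx e) e' : ℝ) * y e'| ≤ η} := by
      intro x hx e _
      have hx := hx (idx e)
      rw [Fintype.sum_eq_single e] at hx
      · exact hx
      · intro e' he'
        have : idx e' ≠ idx e := fun h => he' (Subtype.ext (by rw [← hidxc e', ← hidxc e, h]))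
        have h0 := hoff (idx e') (idx e) this
        rw [hidxc] at h0
        rw [h0, Int.cast_zero, zero_mul]
    refine (measure_mono hsub).trans ?_
    rw [Measure.pi_pi]
    have hcard : Fintype.card {e // p e} = r := by
      rw [← Nat.card_eq_fintype_card]
      exact (Nat.card_congr (Equiv.ofInjective c hc)).symm.trans (Nat.card_fin r)
    calc _ ≤ ∏ _e : {e // p e}, ENNReal.ofReal (2 * φ * η) := by
          refine Finset.prod_le_prod' fun e _ => (h𝒳 e).apply_slab_le hφ ?_ _ _
          have := hdiag (idx e)
          rwa [hidxc] at this
      _ = _ := by rw [Finset.prod_const, Finset.card_univ, hcard]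
  calc _ ≤ ∫⁻ _, ENNReal.ofReal (2 * φ * η) ^ r ∂(Measure.pi fun e : {e // ¬ p e} => 𝒳 e) :=
        lintegral_mono hslice
    _ = _ := by simp

end Anticoncentration

/-! ### Gains of moves as linear forms in the weights -/

section Gains

variable {n : ℕ}

/-- The product of the signs of the two ends of the edge `e`. -/
def edgeSign (γ : Configuration n) (e : Sym2 (Fin n)) : ℤˣ :=
  Sym2.lift ⟨fun a b => γ a * γ b, fun _ _ => mul_comm _ _⟩ e

lemma cutWeight_eq (X : EdgeK n → ℝ) (γ : Configuration n) :
    cutWeight X γ = ∑ e, (1 - ((edgeSign γ e.1 : ℤ) : ℝ)) / 2 * X e := by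
  unfold cutWeight
  refine Finset.sum_congr rfl fun e _ => ?_
  obtain ⟨e, he⟩ := e
  induction e using Sym2.ind with
  | _ a b =>
    simp only [Sym2.map_mk, Sym2.mk_isDiag_iff, edgeSign, Sym2.lift_mk]
    rcases Int.units_eq_one_or (γ a) with h | h <;> rcases Int.units_eq_one_or (γ b) with h' | h' <;>
      simp [h, h']

lemma two_mul_cutWeight_sub (X : EdgeK n → ℝ) (γ γ' : Configuration n) :
    2 * (cutWeight X γ' - cutWeight X γ) =
      ∑ e, (((edgeSign γ e.1 : ℤ) : ℝ) - ((edgeSign γ' e.1 : ℤ) : ℝ)) * X e := by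
  rw [cutWeight_eq, cutWeight_eq, ← Finset.sum_sub_distrib, Finset.mul_sum]
  exact Finset.sum_congr rfl fun e _ => by ring

/-- The integer linear form in the weights given by `gainCoeff`. -/
def gainForm (x : ℕ → Configuration n) (T : Finset ℕ) (b : ℕ → ℤ) (e : EdgeK n) : ℤ :=
  ∑ t ∈ T, b t * ((edgeSign (x t) e.1 : ℤ) - (edgeSign (x (t + 1)) e.1 : ℤ))

lemma gainForm_mk (x : ℕ → Configuration n) (T : Finset ℕ) (b : ℕ → ℤ) {z w : Fin n}
    (h : s(z, w) ∈ (⊤ : SimpleGraph (Fin n)).edgeSet) :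
    gainForm x T b ⟨s(z, w), h⟩ = gainCoeff x T b z w := by
  simp [gainForm, gainCoeff, edgeSign]

lemma sum_gainForm_mul (x : ℕ → Configuration n) (T : Finset ℕ) (b : ℕ → ℤ) (X : EdgeK n → ℝ) :
    ∑ e, (gainForm x T b e : ℝ) * X e =
      ∑ t ∈ T, (b t : ℝ) * (2 * (cutWeight X (x (t + 1)) - cutWeight X (x t))) := by
  simp only [two_mul_cutWeight_sub, gainForm, Finset.mul_sum]
  rw [Finset.sum_comm]
  refine Finset.sum_congr rfl fun e _ => ?_
  push_cast
  rw [Finset.sum_mul]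
  exact Finset.sum_congr rfl fun t _ => by ring

lemma abs_sum_gainForm_mul_le (x : ℕ → Configuration n) (T : Finset ℕ) (b : ℕ → ℤ)
    (X : EdgeK n → ℝ) {ε : ℝ} (A : ℕ) (hε : 0 ≤ ε) (hA : ∑ t ∈ T, |b t| ≤ A)
    (h0 : ∀ t ∈ T, 0 ≤ cutWeight X (x (t + 1)) - cutWeight X (x t))
    (h : ∀ t ∈ T, cutWeight X (x (t + 1)) - cutWeight X (x t) ≤ ε) :
    |∑ e, (gainForm x T b e : ℝ) * X e| ≤ 2 * ε * A := by
  rw [sum_gainForm_mul]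
  calc |∑ t ∈ T, (b t : ℝ) * (2 * (cutWeight X (x (t + 1)) - cutWeight X (x t)))|
      ≤ ∑ t ∈ T, |(b t : ℝ)| * (2 * ε) := by
        refine (Finset.abs_sum_le_sum_abs _ _).trans (Finset.sum_le_sum fun t ht => ?_)
        rw [abs_mul]
        gcongr
        rw [abs_of_nonneg (by linarith [h0 t ht])]
        linarith [h t ht]
    _ = 2 * ε * ((∑ t ∈ T, |b t| : ℤ) : ℝ) := by
        rw [← Finset.sum_mul]; push_cast; ring
    _ ≤ 2 * ε * A := by
        gcongr
        exact_mod_cast hA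

end Gains

/-! ### Records of moves -/

section Records

variable {n : ℕ}

/-- The record of a sequence of `ℓ` moves: for each time, the at most two nodes that move, together
with their signs before the move. If a single node moves, it is listed twice. -/
abbrev MoveRecord (n ℓ : ℕ) : Type := Fin ℓ → (Fin n × ℤˣ) × (Fin n × ℤˣ)

/-- `ρ` is the record of the first `ℓ` moves of `y`. -/
def HasRecord {ℓ : ℕ} (y : ℕ → Configuration n) (ρ : MoveRecord n ℓ) : Prop :=
  ∀ t : Fin ℓ, (∀ z, z ∈ movedSet y t ↔ z = (ρ t).1.1 ∨ z = (ρ t).2.1) ∧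
    y t (ρ t).1.1 = (ρ t).1.2 ∧ y t (ρ t).2.1 = (ρ t).2.2

lemma card_moveRecord (n ℓ : ℕ) : Fintype.card (MoveRecord n ℓ) = (4 * n ^ 2) ^ ℓ := by
  simp only [MoveRecord, Fintype.card_pi, Fintype.card_prod, Fintype.card_fin,
    Fintype.card_units_int, Finset.prod_const, Finset.card_univ]
  congr 1
  ring

lemma exists_hasRecord (y : ℕ → Configuration n) (ℓ : ℕ) (h : ∀ t < ℓ, (movedSet y t).Nonempty)
    (h2 : ∀ t < ℓ, (movedSet y t).card ≤ 2) : ∃ ρ : MoveRecord n ℓ, HasRecord y ρ := by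
  have : ∀ t : Fin ℓ, ∃ q : (Fin n × ℤˣ) × (Fin n × ℤˣ),
      (∀ z, z ∈ movedSet y t ↔ z = q.1.1 ∨ z = q.2.1) ∧ y t q.1.1 = q.1.2 ∧ y t q.2.1 = q.2.2 := by
    intro t
    have h1 := Finset.card_pos.2 (h t t.2)
    have h3 := h2 t t.2
    rcases (by omega : (movedSet y t).card = 1 ∨ (movedSet y t).card = 2) with h4 | h4
    · obtain ⟨a, ha⟩ := Finset.card_eq_one.1 h4
      exact ⟨((a, y t a), (a, y t a)), by simp [ha], rfl, rfl⟩
    · obtain ⟨a, b, _, hab⟩ := Finset.card_eq_two.1 h4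
      exact ⟨((a, y t a), (b, y t b)), by simp [hab], rfl, rfl⟩
  choose ρ hρ using this
  exact ⟨ρ, hρ⟩

lemma HasRecord.movedSet_eq {ℓ : ℕ} {y y' : ℕ → Configuration n} {ρ : MoveRecord n ℓ}
    (hy : HasRecord y ρ) (hy' : HasRecord y' ρ) {t : ℕ} (ht : t < ℓ) :
    movedSet y t = movedSet y' t := by
  ext z
  exact ((hy ⟨t, ht⟩).1 z).trans ((hy' ⟨t, ht⟩).1 z).symm

lemma eq_of_forall_notMem_movedSet {ℓ : ℕ} {y : ℕ → Configuration n} {z : Fin n}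
    (h : ∀ t < ℓ, z ∉ movedSet y t) : ∀ t ≤ ℓ, y t z = y 0 z := by
  intro t
  induction t with
  | zero => intro _; rfl
  | succ t ih =>
    intro ht
    rw [← ih (by omega)]
    by_contra hne
    exact h t (by omega) (mem_movedSet.2 (Ne.symm hne))

/-- The record determines the signs of every node that moves. -/
lemma HasRecord.eq_of_mem {ℓ : ℕ} {y y' : ℕ → Configuration n} {ρ : MoveRecord n ℓ}
    (hy : HasRecord y ρ) (hy' : HasRecord y' ρ) {z : Fin n} {s : ℕ} (hs : s < ℓ)
    (hz : z ∈ movedSet y s) : ∀ t ≤ ℓ, y t z = y' t z := by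
  have hs0 : y s z = y' s z := by
    obtain ⟨h1, h2, h3⟩ := hy ⟨s, hs⟩
    obtain ⟨_, h2', h3'⟩ := hy' ⟨s, hs⟩
    rcases (h1 z).1 hz with rfl | rfl
    · exact h2.trans h2'.symm
    · exact h3.trans h3'.symm
  have hstep : ∀ t < ℓ, (y t z = y' t z ↔ y (t + 1) z = y' (t + 1) z) := by
    intro t ht
    have hm := hy.movedSet_eq hy' ht
    by_cases h : z ∈ movedSet y t
    · have h1 := units_eq_neg_of_ne (mem_movedSet.1 h)
      have h2 := units_eq_neg_of_ne (mem_movedSet.1 (hm ▸ h))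
      rw [h1, h2, neg_inj]
    · have h1 : y t z = y (t + 1) z := by
        by_contra hne
        exact h (mem_movedSet.2 hne)
      have h2 : y' t z = y' (t + 1) z := by
        by_contra hne
        exact h (hm ▸ mem_movedSet.2 hne)
      rw [h1, h2]
  have hall : ∀ t ≤ ℓ, (y t z = y' t z ↔ y 0 z = y' 0 z) := by
    intro t
    induction t with
    | zero => intro _; rfl
    | succ t ih => exact fun ht => (hstep t (by omega)).symm.trans (ih (by omega))
  exact fun t ht => (hall t ht).2 ((hall s hs.le).1 hs0)

lemma gainCoeff_comm (x : ℕ → Configuration n) (T : Finset ℕ) (b : ℕ → ℤ) (z w : Fin n) :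
    gainCoeff x T b z w = gainCoeff x T b w z :=
  Finset.sum_congr rfl fun t _ => by ring

lemma gainCoeff_eq_zero_of_unmoved {ℓ : ℕ} {y : ℕ → Configuration n} {b : ℕ → ℤ} {z w : Fin n}
    (hk : ∑ t ∈ Finset.range ℓ, b t * ((y t w : ℤ) - (y (t + 1) w : ℤ)) = 0)
    (h : ∀ t < ℓ, z ∉ movedSet y t) : gainCoeff y (Finset.range ℓ) b z w = 0 := by
  have h1 := eq_of_forall_notMem_movedSet h
  have h2 : gainCoeff y (Finset.range ℓ) b z w =
      (y 0 z : ℤ) * ∑ t ∈ Finset.range ℓ, b t * ((y t w : ℤ) - (y (t + 1) w : ℤ)) := by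
    rw [gainCoeff, Finset.mul_sum]
    refine Finset.sum_congr rfl fun t ht => ?_
    have ht := Finset.mem_range.1 ht
    rw [h1 t ht.le, h1 (t + 1) ht]
    ring
  rw [h2, hk, mul_zero]

/-- If the nodes that do not move cancel out, the combination of gains depends on the record of the
moves only. -/
lemma HasRecord.gainCoeff_eq {ℓ : ℕ} {y y' : ℕ → Configuration n} {ρ : MoveRecord n ℓ}
    (hy : HasRecord y ρ) (hy' : HasRecord y' ρ) {b : ℕ → ℤ}
    (hk : ∀ z, ∑ t ∈ Finset.range ℓ, b t * ((y t z : ℤ) - (y (t + 1) z : ℤ)) = 0) (z w : Fin n) :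
    gainCoeff y' (Finset.range ℓ) b z w = gainCoeff y (Finset.range ℓ) b z w := by
  have hunm : ∀ z, (∀ t < ℓ, z ∉ movedSet y t) → ∀ t < ℓ, z ∉ movedSet y' t :=
    fun z h t ht => hy.movedSet_eq hy' ht ▸ h t ht
  have hk' : ∀ z, ∑ t ∈ Finset.range ℓ, b t * ((y' t z : ℤ) - (y' (t + 1) z : ℤ)) = 0 := by
    intro z
    by_cases hz : ∀ t < ℓ, z ∉ movedSet y t
    · refine Finset.sum_eq_zero fun t ht => ?_
      have ht := Finset.mem_range.1 ht
      have h1 := eq_of_forall_notMem_movedSet (hunm z hz)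
      rw [h1 t ht.le, h1 (t + 1) ht, sub_self, mul_zero]
    · push Not at hz
      obtain ⟨s, hs, hz⟩ := hz
      rw [← hk z]
      refine Finset.sum_congr rfl fun t ht => ?_
      have ht := Finset.mem_range.1 ht
      rw [hy.eq_of_mem hy' hs hz t ht.le, hy.eq_of_mem hy' hs hz (t + 1) ht]
  by_cases hz : ∀ t < ℓ, z ∉ movedSet y t
  · rw [gainCoeff_eq_zero_of_unmoved (hk w) hz, gainCoeff_eq_zero_of_unmoved (hk' w) (hunm z hz)]
  by_cases hw : ∀ t < ℓ, w ∉ movedSet y t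
  · rw [gainCoeff_comm, gainCoeff_comm y, gainCoeff_eq_zero_of_unmoved (hk z) hw,
      gainCoeff_eq_zero_of_unmoved (hk' z) (hunm w hw)]
  push Not at hz hw
  obtain ⟨s, hs, hz⟩ := hz
  obtain ⟨s', hs', hw⟩ := hw
  refine Finset.sum_congr rfl fun t ht => ?_
  have ht := Finset.mem_range.1 ht
  rw [hy.eq_of_mem hy' hs hz t ht.le, hy.eq_of_mem hy' hs hz (t + 1) ht,
    hy.eq_of_mem hy' hs' hw t ht.le, hy.eq_of_mem hy' hs' hw (t + 1) ht]

lemma HasRecord.gainForm_eq {ℓ : ℕ} {y y' : ℕ → Configuration n} {ρ : MoveRecord n ℓ}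
    (hy : HasRecord y ρ) (hy' : HasRecord y' ρ) {b : ℕ → ℤ}
    (hk : ∀ z, ∑ t ∈ Finset.range ℓ, b t * ((y t z : ℤ) - (y (t + 1) z : ℤ)) = 0) (e : EdgeK n) :
    gainForm y' (Finset.range ℓ) b e = gainForm y (Finset.range ℓ) b e := by
  obtain ⟨e, he⟩ := e
  induction e using Sym2.ind with
  | _ a c => rw [gainForm_mk, gainForm_mk, hy.gainCoeff_eq hy' hk]

end Records

/-! ### The union bound -/

section UnionBound

variable {n : ℕ}

/-- The weights admit, for the moves with record `ρ`, a run with a certificate in which every move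
has gain at most `ε`. -/
def HasSlowWindow (ε : ℝ) (A H : ℕ) {ℓ : ℕ} (ρ : MoveRecord n ℓ) (X : EdgeK n → ℝ) : Prop :=
  ∃ y : ℕ → Configuration n, HasRecord y ρ ∧
    (∃ r : ℕ, ℓ ≤ r * H ∧ ∃ (b : Fin r → ℕ → ℤ) (u w : Fin r → Fin n),
      IsCertificate y (Finset.range ℓ) A b u w) ∧
    ∀ t < ℓ, 0 ≤ cutWeight X (y (t + 1)) - cutWeight X (y t) ∧
      cutWeight X (y (t + 1)) - cutWeight X (y t) ≤ ε

/-- For a fixed record, one certificate serves all runs with this record. -/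
lemma measure_hasSlowWindow_le {φ ε q : ℝ} (hφ : 0 ≤ φ) (hε : 0 ≤ ε) (A H : ℕ)
    (hq : 2 * φ * (2 * ε * A) ≤ q) (𝒳 : EdgeK n → Measure ℝ)
    (h𝒳 : ∀ e, IsSmoothedWeightLaw φ (𝒳 e)) {ℓ : ℕ} (ρ : MoveRecord n ℓ) {Q : ENNReal}
    (hQ : ∀ r : ℕ, ℓ ≤ r * H → ENNReal.ofReal q ^ r ≤ Q) :
    Measure.pi 𝒳 {X | HasSlowWindow ε A H ρ X} ≤ Q := by
  classical
  by_cases hex : ∃ y : ℕ → Configuration n, HasRecord y ρ ∧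
    (∃ r : ℕ, ℓ ≤ r * H ∧ ∃ (b : Fin r → ℕ → ℤ) (u w : Fin r → Fin n),
      IsCertificate y (Finset.range ℓ) A b u w)
  · obtain ⟨y, hy, r, hr, b, u, w, hc⟩ := hex
    have hne : ∀ i, s(u i, w i) ∈ (⊤ : SimpleGraph (Fin n)).edgeSet := fun i => by
      simpa using hc.ne i
    refine le_trans (measure_mono ?_) ((measure_forms_le hφ 𝒳 h𝒳
      (fun i => gainForm y (Finset.range ℓ) (b i)) (fun i => ⟨s(u i, w i), hne i⟩)
      (fun i => by rw [gainForm_mk]; exact hc.diag i)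
      (fun i j hij => by rw [gainForm_mk]; exact hc.offDiag i j hij) (2 * ε * A)).trans
      (le_trans ?_ (hQ r hr)))
    · rintro X ⟨y', hy', -, hgain⟩ i
      have h1 := abs_sum_gainForm_mul_le y' (Finset.range ℓ) (b i) X A hε (hc.sum_abs_le i)
        (fun t ht => (hgain t (Finset.mem_range.1 ht)).1)
        (fun t ht => (hgain t (Finset.mem_range.1 ht)).2)
      simpa only [hy.gainForm_eq hy' (hc.kernel i)] using h1
    · gcongr
  · have : {X | HasSlowWindow ε A H ρ X} = ∅ := by
      refine Set.eq_empty_of_forall_notMem fun X hX => ?_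
      obtain ⟨y, hy, hc, _⟩ := hX
      exact hex ⟨y, hy, hc⟩
    rw [this, measure_empty]
    exact zero_le

lemma measure_exists_hasSlowWindow_le {φ ε : ℝ} (hφ : 0 ≤ φ) (hε : 0 ≤ ε) (A H κ : ℕ)
    (hn : 1 ≤ n)
    (hq : 2 * φ * (2 * ε * A) ≤ ((4 * (n : ℝ) ^ 3) ^ H)⁻¹) (𝒳 : EdgeK n → Measure ℝ)
    (h𝒳 : ∀ e, IsSmoothedWeightLaw φ (𝒳 e)) :
    Measure.pi 𝒳 {X | ∃ k < κ, ∃ ρ : MoveRecord n (2 ^ k), HasSlowWindow ε A H ρ X} ≤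
      ENNReal.ofReal (κ / n) := by
  have hn1 : (1 : ℝ) ≤ n := by exact_mod_cast hn
  have hn3 : (1 : ℝ) ≤ 4 * (n : ℝ) ^ 3 := by nlinarith [one_le_pow₀ hn1 (n := 3)]
  have hset : {X : EdgeK n → ℝ | ∃ k < κ, ∃ ρ : MoveRecord n (2 ^ k), HasSlowWindow ε A H ρ X} =
      ⋃ k ∈ Finset.range κ, ⋃ ρ : MoveRecord n (2 ^ k), {X | HasSlowWindow ε A H ρ X} := by
    ext X
    simp
  have hρ : ∀ k, ∀ ρ : MoveRecord n (2 ^ k), Measure.pi 𝒳 {X | HasSlowWindow ε A H ρ X} ≤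
      ENNReal.ofReal (((4 * (n : ℝ) ^ 3) ^ (2 ^ k))⁻¹) := by
    intro k ρ
    refine measure_hasSlowWindow_le hφ hε A H hq 𝒳 h𝒳 ρ
      fun r hr => ?_
    rw [← ENNReal.ofReal_pow (by positivity)]
    refine ENNReal.ofReal_le_ofReal ?_
    rw [inv_pow, ← pow_mul]
    refine inv_anti₀ (by positivity) (pow_le_pow_right₀ hn3 ?_)
    rwa [mul_comm]
  have hk : ∀ k, Measure.pi 𝒳 (⋃ ρ : MoveRecord n (2 ^ k), {X | HasSlowWindow ε A H ρ X}) ≤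
      ENNReal.ofReal (1 / n) := by
    intro k
    refine (measure_iUnion_fintype_le _ _).trans ((Finset.sum_le_sum fun ρ _ => hρ k ρ).trans ?_)
    rw [Finset.sum_const, Finset.card_univ, card_moveRecord, nsmul_eq_mul,
      ← ENNReal.ofReal_natCast, ← ENNReal.ofReal_mul (by positivity)]
    refine ENNReal.ofReal_le_ofReal ?_
    push_cast
    rw [← inv_pow, ← mul_pow]
    have h1 : 4 * (n : ℝ) ^ 2 * (4 * (n : ℝ) ^ 3)⁻¹ = 1 / n := by field_simp
    rw [h1]
    exact pow_le_of_le_one (by positivity) (by rw [div_le_one (by positivity)]; exact hn1)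
      (by positivity)
  rw [hset]
  refine (measure_biUnion_finset_le _ _).trans ((Finset.sum_le_sum fun k _ => hk k).trans ?_)
  rw [Finset.sum_const, Finset.card_range, nsmul_eq_mul, ← ENNReal.ofReal_natCast,
    ← ENNReal.ofReal_mul (by positivity)]
  exact ENNReal.ofReal_le_ofReal (by rw [mul_one_div])

end UnionBound

/-! ### From windows to the number of steps -/

section Steps

variable {n : ℕ}

lemma sum_window (κ k j : ℕ) (hk : k ≤ κ) (hj : j < 2 ^ (κ - k)) {M : Type*} [AddCommMonoid M]
    (f : ℕ → M) :
    ∑ t ∈ (Finset.range (2 ^ κ)).filter (fun t => t / 2 ^ k = j), f t =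
      ∑ t ∈ Finset.range (2 ^ k), f (j * 2 ^ k + t) := by
  have h : (Finset.range (2 ^ κ)).filter (fun t => t / 2 ^ k = j) =
      Finset.Ico (j * 2 ^ k) (j * 2 ^ k + 2 ^ k) := by
    ext t
    have hpow : 2 ^ κ = 2 ^ (κ - k) * 2 ^ k := by rw [← pow_add]; congr 1; omega
    have h1 : (j + 1) * 2 ^ k ≤ 2 ^ (κ - k) * 2 ^ k := Nat.mul_le_mul_right _ hj
    simp only [Finset.mem_filter, Finset.mem_range, Finset.mem_Ico]
    rw [Nat.div_eq_iff (Nat.two_pow_pos k)]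
    have := Nat.two_pow_pos k
    rw [Nat.add_mul, one_mul] at h1
    omega
  rw [h, Finset.sum_Ico_eq_sum_range, Nat.add_sub_cancel_left]

lemma IsCertificate.shift {x : ℕ → Configuration n} {κ k j A r : ℕ} (hk : k ≤ κ)
    (hj : j < 2 ^ (κ - k)) {b : Fin r → ℕ → ℤ} {u w : Fin r → Fin n}
    (h : IsCertificate x ((Finset.range (2 ^ κ)).filter fun t => t / 2 ^ k = j) A b u w) :
    IsCertificate (fun t => x (j * 2 ^ k + t)) (Finset.range (2 ^ k)) A
      (fun i t => b i (j * 2 ^ k + t)) u w := by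
  have hg : ∀ i z w, gainCoeff (fun t => x (j * 2 ^ k + t)) (Finset.range (2 ^ k))
      (fun t => b i (j * 2 ^ k + t)) z w =
      gainCoeff x ((Finset.range (2 ^ κ)).filter fun t => t / 2 ^ k = j) (b i) z w :=
    fun i z w => (sum_window κ k j hk hj fun t =>
      b i t * ((x t z : ℤ) * (x t w : ℤ) - (x (t + 1) z : ℤ) * (x (t + 1) w : ℤ))).symm
  refine ⟨fun i => ?_, fun i z => ?_, h.ne, fun i => ?_, fun i j' hij => ?_⟩
  · rw [← sum_window κ k j hk hj fun t => |b i t|]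
    exact h.sum_abs_le i
  · exact (sum_window κ k j hk hj fun t => b i t * ((x t z : ℤ) - (x (t + 1) z : ℤ))).symm.trans
      (h.kernel i z)
  · rw [hg]; exact h.diag i
  · rw [hg]; exact h.offDiag i j' hij

/-- If the weights have no slow window, then a reduced run of `2 ^ κ` improving moves improves the
cut by more than `ε`. -/
lemma lt_cutWeight_sub_of_isReducedRun {ε : ℝ} {κ : ℕ} (hκ : 0 < κ)
    (hn : 2 ^ 34 * n * κ ^ 4 ≤ 2 ^ κ) {X : EdgeK n → ℝ}
    (hX : ¬ ∃ k < κ, ∃ ρ : MoveRecord n (2 ^ k),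
      HasSlowWindow ε (4 * κ + 1) (2 ^ 59 * κ ^ 8) ρ X)
    {x : ℕ → Configuration n} (hx : IsReducedRun x (2 ^ κ))
    (hinc : ∀ t < 2 ^ κ, cutWeight X (x t) < cutWeight X (x (t + 1))) :
    ε < cutWeight X (x (2 ^ κ)) - cutWeight X (x 0) := by
  by_contra! hle
  refine hX ?_
  have hstep : ∀ t < 2 ^ κ, cutWeight X (x (t + 1)) - cutWeight X (x t) ≤ ε := by
    intro t ht
    rw [← Finset.sum_range_sub (fun t => cutWeight X (x t))] at hle
    exact (Finset.single_le_sum (f := fun t => cutWeight X (x (t + 1)) - cutWeight X (x t))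
      (fun s hs => (sub_pos.2 (hinc s (Finset.mem_range.1 hs))).le)
      (Finset.mem_range.2 ht)).trans hle
  obtain ⟨k, hk, j, hj, r, hr, b, u, w, hc⟩ := exists_isCertificate x κ hκ hx hn
  have hlt : ∀ t < 2 ^ k, j * 2 ^ k + t < 2 ^ κ := by
    intro t ht
    have hpow : 2 ^ κ = 2 ^ (κ - k) * 2 ^ k := by rw [← pow_add]; congr 1; omega
    have h1 : (j + 1) * 2 ^ k ≤ 2 ^ (κ - k) * 2 ^ k := Nat.mul_le_mul_right _ hj
    rw [Nat.add_mul, one_mul] at h1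
    omega
  obtain ⟨ρ, hρ⟩ := exists_hasRecord (fun t => x (j * 2 ^ k + t)) (2 ^ k)
    (fun t ht => hx.nonempty _ (hlt t ht)) (fun t ht => hx.card_le _ (hlt t ht))
  exact ⟨k, hk, ρ, fun t => x (j * 2 ^ k + t), hρ, ⟨r, hr, _, u, w, hc.shift hk.le hj⟩,
    fun t ht => ⟨(sub_pos.2 (hinc _ (hlt t ht))).le, hstep _ (hlt t ht)⟩⟩

lemma cutWeight_sub_le {X : EdgeK n → ℝ} (hX : ∀ e, |X e| ≤ 1) (γ γ' : Configuration n) :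
    cutWeight X γ' - cutWeight X γ ≤ (n : ℝ) ^ 2 := by
  have h1 := two_mul_cutWeight_sub X γ γ'
  have h2 : ∑ e, (((edgeSign γ e.1 : ℤ) : ℝ) - ((edgeSign γ' e.1 : ℤ) : ℝ)) * X e ≤
      ∑ _e : EdgeK n, (2 : ℝ) := by
    refine Finset.sum_le_sum fun e _ => ?_
    have h3 : |((edgeSign γ e.1 : ℤ) : ℝ) - ((edgeSign γ' e.1 : ℤ) : ℝ)| ≤ 2 := by
      rcases Int.units_eq_one_or (edgeSign γ e.1) with h | h <;>
        rcases Int.units_eq_one_or (edgeSign γ' e.1) with h' | h' <;> simp [h, h'] <;> norm_num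
    calc _ ≤ |(((edgeSign γ e.1 : ℤ) : ℝ) - ((edgeSign γ' e.1 : ℤ) : ℝ)) * X e| := le_abs_self _
      _ ≤ 2 * 1 := by rw [abs_mul]; exact mul_le_mul h3 (hX e) (abs_nonneg _) (by norm_num)
      _ = 2 := by norm_num
  have h4 : (Fintype.card (EdgeK n) : ℝ) ≤ (n : ℝ) ^ 2 := by
    have h5 : Fintype.card (EdgeK n) ≤ n ^ 2 := by
      refine (Fintype.card_subtype_le _).trans ?_
      have h6 : Fintype.card (Sym2 (Fin n)) ≤ Fintype.card (Fin n × Fin n) :=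
        Fintype.card_le_of_surjective (fun p : Fin n × Fin n => s(p.1, p.2))
          fun e => by induction e using Sym2.ind with | _ a b => exact ⟨(a, b), rfl⟩
      rw [Fintype.card_prod, Fintype.card_fin] at h6
      rwa [sq]
    exact_mod_cast h5
  rw [Finset.sum_const, Finset.card_univ, nsmul_eq_mul] at h2
  linarith

lemma IsReducedRun.shift {x : ℕ → Configuration n} {N : ℕ} (hx : IsReducedRun x N) {a M : ℕ}
    (h : a + M ≤ N) : IsReducedRun (fun t => x (a + t)) M where
  nonempty t ht := hx.nonempty (a + t) (by omega)
  card_le t ht := hx.card_le (a + t) (by omega)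
  ne s t hst ht := hx.ne (a + s) (a + t) (by omega) (by omega)
  ne_flip s t hst ht := hx.ne_flip (a + s) (a + t) (by omega) (by omega)

/-- The number of steps of a reduced run of improving moves, for weights without slow windows. -/
lemma length_le_of_isReducedRun {ε : ℝ} (hε : 0 < ε) {κ : ℕ} (hκ : 0 < κ)
    (hn : 2 ^ 34 * n * κ ^ 4 ≤ 2 ^ κ) {X : EdgeK n → ℝ} (hX1 : ∀ e, |X e| ≤ 1)
    (hX : ¬ ∃ k < κ, ∃ ρ : MoveRecord n (2 ^ k),
      HasSlowWindow ε (4 * κ + 1) (2 ^ 59 * κ ^ 8) ρ X)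
    {x : ℕ → Configuration n} {N : ℕ} (hx : IsReducedRun x N)
    (hinc : ∀ t < N, cutWeight X (x t) < cutWeight X (x (t + 1))) :
    (N : ℝ) ≤ ((n : ℝ) ^ 2 / ε + 1) * 2 ^ κ := by
  have hblock : ∀ M : ℕ, M * 2 ^ κ ≤ N →
      M * ε ≤ cutWeight X (x (M * 2 ^ κ)) - cutWeight X (x 0) := by
    intro M
    induction M with
    | zero => intro _; simp
    | succ M ih =>
      intro hM
      rw [Nat.add_mul, one_mul] at hM
      have h1 := ih (by omega)
      have h2 := lt_cutWeight_sub_of_isReducedRun hκ hn hX (hx.shift hM)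
        (fun t ht => hinc (M * 2 ^ κ + t) (by omega))
      rw [Nat.add_mul, one_mul]
      simp only [add_zero] at h2
      push_cast
      linarith
  have h1 := hblock (N / 2 ^ κ) (Nat.div_mul_le_self _ _)
  have h2 := h1.trans (cutWeight_sub_le hX1 _ _)
  have h3 : ((N / 2 ^ κ : ℕ) : ℝ) ≤ (n : ℝ) ^ 2 / ε := (le_div_iff₀ hε).2 h2
  have h4 : N ≤ (N / 2 ^ κ + 1) * 2 ^ κ := by
    have := Nat.lt_div_mul_add (a := N) (b := 2 ^ κ) (by positivity)
    rw [Nat.add_mul, one_mul]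
    exact this.le
  calc (N : ℝ) ≤ (((N / 2 ^ κ : ℕ) : ℝ) + 1) * 2 ^ κ := by exact_mod_cast h4
    _ ≤ _ := by gcongr

lemma cutWeight_lt_of_lt {X : EdgeK n → ℝ} {x : ℕ → Configuration n} {N : ℕ}
    (hinc : ∀ t < N, cutWeight X (x t) < cutWeight X (x (t + 1))) {s t : ℕ} (hst : s < t)
    (ht : t ≤ N) : cutWeight X (x s) < cutWeight X (x t) := by
  induction t, hst using Nat.le_induction with
  | base => exact hinc s (by omega)
  | succ t hst ih => exact (ih (by omega)).trans (hinc t (by omega))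

lemma movedSet_nonempty_of_lt {X : EdgeK n → ℝ} {x : ℕ → Configuration n} {t : ℕ}
    (h : cutWeight X (x t) < cutWeight X (x (t + 1))) : (movedSet x t).Nonempty := by
  rw [Finset.nonempty_iff_ne_empty]
  intro h0
  have : x t = x (t + 1) := funext fun z => by
    by_contra hz
    exact Finset.notMem_empty z (h0 ▸ mem_movedSet.2 hz)
  rw [this] at h
  exact lt_irrefl _ h

/-- In a run of 2-FLIP, the pivoting rule excludes a return to a configuration that arises by a
part of an earlier move, since that configuration is not better than the result of the move. -/
lemma isReducedRun_of_twoFlipStep {X : EdgeK n → ℝ} {x : ℕ → Configuration n} {N : ℕ}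
    (h : ∀ t < N, TwoFlipStep X (x t) (x (t + 1))) : IsReducedRun x N := by
  have hinc : ∀ t < N, cutWeight X (x t) < cutWeight X (x (t + 1)) := fun t ht => (h t ht).2.1
  refine ⟨fun t ht => movedSet_nonempty_of_lt (hinc t ht), fun t ht => (h t ht).1, ?_, ?_⟩
  · intro s t hst ht heq
    have := cutWeight_lt_of_lt hinc hst ht
    rw [heq] at this
    exact lt_irrefl _ this
  · intro s t hst ht a ha heq
    have h1 := (h s (by omega)).2.2 a (mem_movedSet.1 ha)
    have h2 := cutWeight_lt_of_lt hinc hst ht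
    rw [heq] at h2
    exact absurd h2 (not_lt.2 h1)

lemma prod_eq_neg_one_pow_mul_prod (γ γ' : Configuration n) :
    ∏ z, γ' z = (-1) ^ hammingDist γ γ' * ∏ z, γ z := by
  have h : ∀ z, γ' z = (if γ z ≠ γ' z then -1 else 1) * γ z := by
    intro z
    split_ifs with h
    · rw [units_eq_neg_of_ne h, neg_one_mul]
    · rw [one_mul, not_not.1 h]
  rw [Finset.prod_congr rfl fun z _ => h z, Finset.prod_mul_distrib, Finset.prod_ite,
    Finset.prod_const, Finset.prod_const_one, mul_one]
  rfl

/-- In a run of Pure 2-FLIP, the product of all signs is invariant, while a single flip changes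
it. -/
lemma isReducedRun_of_pureTwoFlipStep {X : EdgeK n → ℝ} {x : ℕ → Configuration n} {N : ℕ}
    (h : ∀ t < N, PureTwoFlipStep X (x t) (x (t + 1))) : IsReducedRun x N := by
  have hinc : ∀ t < N, cutWeight X (x t) < cutWeight X (x (t + 1)) := fun t ht => (h t ht).2
  have hprod : ∀ t ≤ N, ∏ z, x t z = ∏ z, x 0 z := by
    intro t
    induction t with
    | zero => intro _; rfl
    | succ t ih =>
      intro ht
      rw [← ih (by omega), prod_eq_neg_one_pow_mul_prod (x t), (h t (by omega)).1]
      simp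
  refine ⟨fun t ht => movedSet_nonempty_of_lt (hinc t ht), fun t ht => (h t ht).1.le, ?_, ?_⟩
  · intro s t hst ht heq
    have := cutWeight_lt_of_lt hinc hst ht
    rw [heq] at this
    exact lt_irrefl _ this
  · intro s t hst ht a ha heq
    have h1 : hammingDist (x s) (x t) = 1 := by
      rw [heq, hammingDist, Finset.card_eq_one]
      refine ⟨a, ?_⟩
      ext z
      simp only [Finset.mem_filter, Finset.mem_univ, true_and, Finset.mem_singleton]
      by_cases hz : z = a
      · subst hz
        simpa using mem_movedSet.1 ha
      · simp [hz]
    have h2 := prod_eq_neg_one_pow_mul_prod (x s) (x t)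
    rw [h1, hprod t ht, hprod s (by omega), pow_one] at h2
    rcases Int.units_eq_one_or (∏ z, x 0 z) with h3 | h3 <;> rw [h3] at h2 <;>
      exact absurd h2 (by decide)

end Steps

/-! ### The choice of the parameters -/

section Parameters

/-- The logarithm to base two of the length of a block of moves: `2 ^ logBlock n` lies between
`n ^ 3` and `8 * n ^ 3`. -/
def logBlock (n : ℕ) : ℕ := 3 * (Nat.log 2 n + 1)

lemma pow_three_le_two_pow_logBlock (n : ℕ) : n ^ 3 ≤ 2 ^ logBlock n := by
  rw [logBlock, mul_comm, pow_mul]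
  exact Nat.pow_le_pow_left (Nat.lt_pow_succ_log_self one_lt_two n).le 3

lemma two_pow_logBlock_le {n : ℕ} (hn : n ≠ 0) : 2 ^ logBlock n ≤ 8 * n ^ 3 := by
  rw [logBlock, mul_comm, pow_mul]
  calc (2 ^ (Nat.log 2 n + 1)) ^ 3 = 8 * (2 ^ Nat.log 2 n) ^ 3 := by ring
    _ ≤ 8 * n ^ 3 := Nat.mul_le_mul_left _ (Nat.pow_le_pow_left (Nat.pow_log_le_self 2 hn) 3)

lemma one_le_log_of_four_le {n : ℕ} (hn : 4 ≤ n) : 1 ≤ Real.log n := by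
  rw [Real.le_log_iff_exp_le (by positivity)]
  have h : (4 : ℝ) ≤ n := by exact_mod_cast hn
  linarith [Real.exp_one_lt_d9]

lemma logBlock_le {n : ℕ} (hn : 4 ≤ n) : (logBlock n : ℝ) ≤ 9 * Real.log n := by
  have h1 : (Nat.log 2 n : ℝ) ≤ Real.log n / Real.log 2 := by
    have := Real.natLog_le_logb n 2
    simpa [Real.logb] using this
  have h2 := one_le_log_of_four_le hn
  have h3 : Real.log n / Real.log 2 ≤ 2 * Real.log n := by
    rw [div_le_iff₀ (Real.log_pos one_lt_two)]
    nlinarith [Real.log_two_gt_d9]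
  rw [logBlock]
  push_cast
  linarith

lemma eventually_logBlock :
    ∀ᶠ n : ℕ in atTop, 4 ≤ n ∧ 2 ^ 34 * n * logBlock n ^ 4 ≤ 2 ^ logBlock n ∧
      4 * logBlock n + 1 ≤ n ^ 2 := by
  have h : ∀ᶠ n : ℕ in atTop, ‖Real.log n ^ 4‖ ≤ (2 ^ 34 * 9 ^ 4 : ℝ)⁻¹ * ‖(n : ℝ)‖ :=
    tendsto_natCast_atTop_atTop.eventually
      ((Real.isLittleO_pow_log_id_atTop (n := 4)).bound (by positivity))
  filter_upwards [h, eventually_ge_atTop 4] with n hn h4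
  have hn1 : (4 : ℝ) ≤ n := by exact_mod_cast h4
  have hlog := logBlock_le h4
  have h1 := one_le_log_of_four_le h4
  rw [Real.norm_of_nonneg (by positivity), Real.norm_of_nonneg (by positivity),
    ← div_eq_inv_mul, le_div_iff₀ (by positivity)] at hn
  have hκ4 : (2 : ℝ) ^ 34 * (logBlock n : ℝ) ^ 4 ≤ n := by
    calc (2 : ℝ) ^ 34 * (logBlock n : ℝ) ^ 4 ≤ 2 ^ 34 * (9 * Real.log n) ^ 4 := by gcongr
      _ = Real.log n ^ 4 * (2 ^ 34 * 9 ^ 4) := by ring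
      _ ≤ n := hn
  have hκ4' : 2 ^ 34 * logBlock n ^ 4 ≤ n := by exact_mod_cast hκ4
  have hpos : 1 ≤ logBlock n := by rw [logBlock]; omega
  refine ⟨h4, ?_, ?_⟩
  · calc 2 ^ 34 * n * logBlock n ^ 4 = n * (2 ^ 34 * logBlock n ^ 4) := by ring
      _ ≤ n * n := Nat.mul_le_mul_left _ hκ4'
      _ ≤ n ^ 3 := by rw [← sq]; exact Nat.pow_le_pow_right (by omega) (by norm_num)
      _ ≤ _ := pow_three_le_two_pow_logBlock n
  · have h5 : logBlock n ≤ logBlock n ^ 4 := Nat.le_self_pow (by norm_num) _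
    have h6 : n ≤ n ^ 2 := Nat.le_self_pow (by norm_num) _
    omega

/-- The number of blocks times their length, if each block gains as much as the union bound over
the records requires. -/
lemma step_bound {n κ H : ℕ} (hn : 4 ≤ n) (h : 4 * κ + 1 ≤ n ^ 2) (hκ : 2 ^ κ ≤ 8 * n ^ 3)
    (hH : 1 ≤ H) {φ : ℝ} (hφ : 1 ≤ 2 * φ) :
    ((n : ℝ) ^ 2 / (((4 * (n : ℝ) ^ 3) ^ H)⁻¹ / (4 * φ * (4 * κ + 1))) + 1) * 2 ^ κ ≤
      φ * (n : ℝ) ^ (15 * H) := by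
  have hn1 : (4 : ℝ) ≤ n := by exact_mod_cast hn
  have h' : (4 * κ + 1 : ℝ) ≤ (n : ℝ) ^ 2 := by exact_mod_cast h
  have hκ' : (2 : ℝ) ^ κ ≤ 8 * (n : ℝ) ^ 3 := by exact_mod_cast hκ
  have hpow : (4 * (n : ℝ) ^ 3) ^ H ≤ (n : ℝ) ^ (4 * H) := by
    rw [pow_mul]
    refine pow_le_pow_left₀ (by positivity) ?_ H
    rw [pow_succ _ 3, mul_comm]
    gcongr
  have hφ0 : 0 < φ := by linarith
  have hone : (1 : ℝ) ≤ (n : ℝ) ^ (4 * H + 5) := one_le_pow₀ (by linarith)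
  calc _ = (φ * (4 * (4 * κ + 1) * (n : ℝ) ^ 2 * (4 * (n : ℝ) ^ 3) ^ H) + 1) * 2 ^ κ := by
        congr 2
        field_simp
    _ ≤ (φ * (4 * (n : ℝ) ^ 2 * (n : ℝ) ^ 2 * (n : ℝ) ^ (4 * H)) + 2 * φ) *
          (8 * (n : ℝ) ^ 3) := by gcongr
    _ = φ * (4 * (n : ℝ) ^ (4 * H + 4) + 2) * (8 * (n : ℝ) ^ 3) := by ring
    _ ≤ φ * (n * (n : ℝ) ^ (4 * H + 4) + 2) * (n ^ 2 * (n : ℝ) ^ 3) := by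
        gcongr
        nlinarith
    _ = φ * ((n : ℝ) ^ (4 * H + 5) + 2) * (n : ℝ) ^ 5 := by ring
    _ ≤ φ * (n * (n : ℝ) ^ (4 * H + 5)) * (n : ℝ) ^ 5 := by
        gcongr
        nlinarith
    _ = φ * (n : ℝ) ^ (4 * H + 11) := by ring
    _ ≤ φ * (n : ℝ) ^ (15 * H) := by
        refine mul_le_mul_of_nonneg_left (pow_le_pow_right₀ (by linarith) ?_) hφ0.le
        omega

lemma pow_le_rpow_log {n H : ℕ} (hn : 4 ≤ n) (hH : (H : ℝ) = 2 ^ 59 * (logBlock n : ℝ) ^ 8) :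
    (n : ℝ) ^ (15 * H) ≤ (n : ℝ) ^ ((15 * 2 ^ 59 * 9 ^ 8 : ℝ) * Real.log n ^ 10) := by
  have hn1 : (4 : ℝ) ≤ n := by exact_mod_cast hn
  have h1 := one_le_log_of_four_le hn
  rw [← Real.rpow_natCast]
  refine Real.rpow_le_rpow_of_exponent_le (by linarith) ?_
  rw [Nat.cast_mul, hH, Nat.cast_ofNat]
  calc (15 * (2 ^ 59 * (logBlock n : ℝ) ^ 8)) ≤ 15 * (2 ^ 59 * (9 * Real.log n) ^ 8) := by
        gcongr
        exact logBlock_le hn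
    _ = (15 * 2 ^ 59 * 9 ^ 8) * Real.log n ^ 8 := by ring
    _ ≤ _ := mul_le_mul_of_nonneg_left (pow_le_pow_right₀ h1 (by norm_num)) (by positivity)

lemma IsSmoothedWeightLaw.one_le_two_mul {φ : ℝ} {μ : Measure ℝ} (h : IsSmoothedWeightLaw φ μ)
    (hφ : 0 ≤ φ) : 1 ≤ 2 * φ := by
  have := h.isProbabilityMeasure
  have h1 : μ (Set.Icc (-1) 1) = 1 := (prob_compl_eq_zero_iff measurableSet_Icc).1 h.supported
  obtain ⟨f, -, hf, hμ⟩ := h.density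
  rw [hμ, withDensity_apply _ measurableSet_Icc] at h1
  have h2 := h1.symm.le.trans (lintegral_mono (μ := volume.restrict (Set.Icc (-1) 1)) hf)
  rw [lintegral_const, Measure.restrict_apply_univ, Real.volume_Icc,
    ← ENNReal.ofReal_mul hφ, ENNReal.one_le_ofReal] at h2
  linarith

lemma measure_exists_one_lt_abs {n : ℕ} {φ : ℝ} (𝒳 : EdgeK n → Measure ℝ)
    (h𝒳 : ∀ e, IsSmoothedWeightLaw φ (𝒳 e)) :
    Measure.pi 𝒳 {X | ¬ ∀ e, |X e| ≤ 1} = 0 := by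
  have : ∀ e, IsProbabilityMeasure (𝒳 e) := fun e => (h𝒳 e).isProbabilityMeasure
  have hset : {X : EdgeK n → ℝ | ¬ ∀ e, |X e| ≤ 1} =
      ⋃ e, Function.eval e ⁻¹' (Set.Icc (-1 : ℝ) 1)ᶜ := by
    ext X
    simp [abs_le]
  rw [hset, measure_iUnion_null_iff]
  intro e
  rw [(measurePreserving_eval 𝒳 e).measure_preimage
    measurableSet_Icc.compl.nullMeasurableSet]
  exact (h𝒳 e).supported

/-- The failure probability of the step bound, for local searches all of whose runs are reduced and
improve the cut. -/
lemma measure_not_terminatesWithin_le {n : ℕ} (hn : 4 ≤ n)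
    (h1 : 2 ^ 34 * n * logBlock n ^ 4 ≤ 2 ^ logBlock n) (h2 : 4 * logBlock n + 1 ≤ n ^ 2)
    {φ : ℝ} (hφ : 0 < φ) (𝒳 : EdgeK n → Measure ℝ) (h𝒳 : ∀ e, IsSmoothedWeightLaw φ (𝒳 e))
    (step : (EdgeK n → ℝ) → Configuration n → Configuration n → Prop)
    (hinc : ∀ X γ γ', step X γ γ' → cutWeight X γ < cutWeight X γ')
    (hred : ∀ X (x : ℕ → Configuration n) N, (∀ t < N, step X (x t) (x (t + 1))) →
      IsReducedRun x N) :
    Measure.pi 𝒳 {X : EdgeK n → ℝ | TerminatesWithin (step X)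
        (φ * (n : ℝ) ^ ((15 * 2 ^ 59 * 9 ^ 8 : ℝ) * Real.log n ^ 10))}ᶜ ≤
      ENNReal.ofReal (logBlock n / n) := by
  -- A density on an interval of length two is not bounded by less than one half.
  have hφ1 : 1 ≤ 2 * φ := by
    refine (h𝒳 ⟨s(⟨0, by omega⟩, ⟨1, by omega⟩), ?_⟩).one_le_two_mul hφ.le
    simp
  set κ := logBlock n with hκ
  have hκpos : 0 < κ := by rw [hκ, logBlock]; omega
  obtain ⟨H, hH⟩ : ∃ H, H = 2 ^ 59 * κ ^ 8 := ⟨_, rfl⟩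
  have hH1 : 1 ≤ H := by rw [hH]; exact Nat.mul_pos (by norm_num) (pow_pos hκpos 8)
  have hHr : (H : ℝ) = 2 ^ 59 * (κ : ℝ) ^ 8 := by
    rw [hH, Nat.cast_mul, Nat.cast_pow, Nat.cast_pow, Nat.cast_ofNat]
  set ε : ℝ := ((4 * (n : ℝ) ^ 3) ^ H)⁻¹ / (4 * φ * (4 * κ + 1)) with hε
  have hn0 : (0 : ℝ) < n := by exact_mod_cast (by omega : 0 < n)
  have hε0 : 0 < ε := by positivity
  have hq : 2 * φ * (2 * ε * (4 * κ + 1 : ℕ)) ≤ ((4 * (n : ℝ) ^ 3) ^ H)⁻¹ := by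
    refine le_of_eq ?_
    push_cast
    have : 2 * φ * (2 * ε * (4 * κ + 1)) = ε * (4 * φ * (4 * κ + 1)) := by ring
    rw [this, hε, div_mul_cancel₀ _ (by positivity)]
  refine le_trans (measure_mono (t := {X | ∃ k < κ, ∃ ρ : MoveRecord n (2 ^ k),
    HasSlowWindow ε (4 * κ + 1) H ρ X} ∪ {X | ¬ ∀ e, |X e| ≤ 1}) ?_)
    ((measure_union_le _ _).trans ?_)
  · intro X hX
    by_contra hX'
    rw [Set.mem_union, not_or] at hX'
    refine hX fun N x hx => ?_
    have hslow := hX'.1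
    rw [hH] at hslow
    exact (length_le_of_isReducedRun hε0 hκpos h1 (not_not.1 hX'.2) hslow (hred X x N hx)
      fun t ht => hinc X _ _ (hx t ht)).trans ((step_bound hn h2
        (two_pow_logBlock_le (by omega)) hH1 hφ1).trans
        (mul_le_mul_of_nonneg_left (pow_le_rpow_log hn hHr) hφ.le))
  · rw [measure_exists_one_lt_abs 𝒳 h𝒳, add_zero]
    exact measure_exists_hasSlowWindow_le hφ.le hε0.le _ _ κ (by omega) hq 𝒳 h𝒳

lemma tendsto_logBlock_div : Tendsto (fun n : ℕ => (logBlock n : ℝ) / n) atTop (𝓝 0) := by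
  have h : Tendsto (fun n : ℕ => 9 * (Real.log n / n)) atTop (𝓝 0) := by
    have := (Real.isLittleO_log_id_atTop.tendsto_div_nhds_zero.comp
      tendsto_natCast_atTop_atTop).const_mul (9 : ℝ)
    simpa using this
  refine squeeze_zero' (Eventually.of_forall fun n => by positivity) ?_ h
  filter_upwards [eventually_ge_atTop 4] with n hn
  rw [← mul_div_assoc]
  gcongr
  exact logBlock_le hn

end Parameters

/-- There are an absolute constant `C` and a function `δ` of `n` alone with `δ n → 0`, such that
for independent edge weights the failure probability of the step bound
`φ * n ^ (C * (log n) ^ 10)` is at most `δ n`, for 2-FLIP and for Pure 2-FLIP. -/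
theorem theorem2 :
    ∃ (C : ℝ) (δ : ℕ → ℝ), Tendsto δ atTop (𝓝 0) ∧
      ∀ (n : ℕ) (φ : ℝ), 0 < φ →
        ∀ 𝒳 : EdgeK n → Measure ℝ, (∀ e, IsSmoothedWeightLaw φ (𝒳 e)) →
          Measure.pi 𝒳 {X : EdgeK n → ℝ | TerminatesWithin (TwoFlipStep X)
              (φ * (n : ℝ) ^ (C * Real.log n ^ 10))}ᶜ ≤ ENNReal.ofReal (δ n) ∧
          Measure.pi 𝒳 {X : EdgeK n → ℝ | TerminatesWithin (PureTwoFlipStep X)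
              (φ * (n : ℝ) ^ (C * Real.log n ^ 10))}ᶜ ≤ ENNReal.ofReal (δ n) := by
  obtain ⟨n₀, hn₀⟩ := eventually_atTop.1 eventually_logBlock
  -- For small `n` the bound `1` on the failure probability is trivial.
  refine ⟨15 * 2 ^ 59 * 9 ^ 8, fun n => if n₀ ≤ n then (logBlock n : ℝ) / n else 1, ?_, ?_⟩
  · refine tendsto_logBlock_div.congr' ?_
    filter_upwards [eventually_ge_atTop n₀] with n hn
    rw [if_pos hn]
  · intro n φ hφ 𝒳 h𝒳
    have : ∀ e, IsProbabilityMeasure (𝒳 e) := fun e => (h𝒳 e).isProbabilityMeasure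
    by_cases hn : n₀ ≤ n
    · obtain ⟨h4, h1, h2⟩ := hn₀ n hn
      simp only [if_pos hn]
      exact ⟨measure_not_terminatesWithin_le h4 h1 h2 hφ 𝒳 h𝒳 TwoFlipStep
          (fun X γ γ' h => h.2.1) fun X x N h => isReducedRun_of_twoFlipStep h,
        measure_not_terminatesWithin_le h4 h1 h2 hφ 𝒳 h𝒳 PureTwoFlipStep
          (fun X γ γ' h => h.2) fun X x N h => isReducedRun_of_pureTwoFlipStep h⟩
    · simp only [if_neg hn, ENNReal.ofReal_one]
      exact ⟨prob_le_one, prob_le_one⟩
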